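/- Let $k$ be a field and let $A=\bigoplus_{n\ge 0}A_n$ be an $\mathbb{N}$-graded $k$-algebra that is locally finite, that is, $\dim_k A_n<\infty$ for every $n$. Write $A^e=A\otimes_k A^{\mathrm{op}}$, and identify $k$-central $(A,A)$-bimodules with left $A^e$-modules via $(a\otimes b^{\mathrm{op}})\cdot m=amb$, or with right $A^e$-modules via $m\cdot(b\otimes a^{\mathrm{op}})=amb$. Suppose that $A$ is twisted Calabi-Yau of dimension $1$, that is: (i) $A$ is homologically smooth: as a left $A^e$-module, $A$ has a projective resolution of finite length by finitely generated projective modules; (ii) $\operatorname{Ext}^i_{A^e}(A,A^e)=0$ for all $i\neq 1$, and there is an invertible $k$-central $(A,A)$-bimodule $U$ (that is, one for which there is a $k$-central $(A,A)$-bimodule $V$ with $U\otimes_A V\cong A\cong V\otimes_A U$ as bimodules) such that $\operatorname{Ext}^1_{A^e}(A,A^e)\cong U$ as $(A,A)$-bimodules, where $\operatorname{Ext}^1_{A^e}(A,A^e)$ is a right $A^e$-module via the right $A^e$-module structure of the second argument. Then $A$ is left noetherian and right noetherian. -/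

import Mathlib

open scoped TensorProduct
open MulOpposite CategoryTheory CategoryTheory.Limits CategoryTheory.Abelian

universe v u

section Perfect

/-- A left module over a (noncommutative) ring is perfect if it has a projective resolution of
finite length whose terms are all finitely generated. -/
def IsPerfectModule {R : Type u} [Ring R] (M : ModuleCat.{u} R) : Prop :=
  ∃ P : ProjectiveResolution M,
    (∀ i, Module.Finite R (P.complex.X i)) ∧ ∃ n, ∀ i, n < i → IsZero (P.complex.X i)

/-- Right multiplication by `r`, as an endomorphism of the left regular module of `R`. -/
noncomputable def rightMulEnd (R : Type u) [Ring R] (r : R) :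
    ModuleCat.of R R ⟶ ModuleCat.of R R :=
  ModuleCat.ofHom (LinearMap.toSpanSingleton R R r)

/-- The right action of `r : R` on `Ext^i_R(M, R)` that is induced by the right `R`-module
structure of the second argument. -/
noncomputable def extRightMul {R : Type u} [Ring R] {M : ModuleCat.{u} R} {i : ℕ}
    (e : Ext.{u} M (ModuleCat.of R R) i) (r : R) : Ext.{u} M (ModuleCat.of R R) i :=
  e.comp (Ext.mk₀ (rightMulEnd R r)) (add_zero i)

end Perfect

section Bimodules

variable (k : Type v) [Field k] (A : Type u) [Ring A] [Algebra k A]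

/-- A `k`-central `(A, A)`-bimodule; the right action of `a` is the action of `op a`. The two
scalar tower fields say that both actions restrict to the same action of `k`. -/
structure CentralBimodule where
  carrier : Type u
  [addCommGroup : AddCommGroup carrier]
  [moduleBase : Module k carrier]
  [moduleLeft : Module A carrier]
  [moduleRight : Module Aᵐᵒᵖ carrier]
  [smulComm : SMulCommClass A Aᵐᵒᵖ carrier]
  [towerLeft : IsScalarTower k A carrier]
  [towerRight : IsScalarTower k Aᵐᵒᵖ carrier]

attribute [instance] CentralBimodule.addCommGroup CentralBimodule.moduleBase
  CentralBimodule.moduleLeft CentralBimodule.moduleRight CentralBimodule.smulComm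
  CentralBimodule.towerLeft CentralBimodule.towerRight

variable {k A}

/-- The relations `(u a) ⊗ v = u ⊗ (a v)` in `U ⊗_k V`. -/
def balancedRelations (U V : CentralBimodule k A) :
    Submodule k (U.carrier ⊗[k] V.carrier) :=
  Submodule.span k {x | ∃ (u : U.carrier) (a : A) (w : V.carrier),
    x = (op a • u) ⊗ₜ[k] w - u ⊗ₜ[k] (a • w)}

/-- The tensor product `U ⊗_A V` over the noncommutative ring `A`. -/
abbrev BalancedTensor (U V : CentralBimodule k A) : Type _ :=
  (U.carrier ⊗[k] V.carrier) ⧸ balancedRelations U V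

/-- `U ⊗_A V ≅ A` as `(A, A)`-bimodules, where `a (u ⊗ v) b = (a u) ⊗ (v b)` in `U ⊗_A V`. -/
def TensorIsoRegular (U V : CentralBimodule k A) : Prop :=
  ∃ φ : BalancedTensor U V ≃ₗ[k] A, ∀ (a b : A) (u : U.carrier) (w : V.carrier),
    φ ((balancedRelations U V).mkQ ((a • u) ⊗ₜ[k] (op b • w))) =
      a * φ ((balancedRelations U V).mkQ (u ⊗ₜ[k] w)) * b

/-- `U` is invertible: there is a `V` with `U ⊗_A V ≅ A ≅ V ⊗_A U` as bimodules. -/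
def CentralBimodule.IsInvertible (U : CentralBimodule k A) : Prop :=
  ∃ V : CentralBimodule k A, TensorIsoRegular U V ∧ TensorIsoRegular V U

end Bimodules

section CalabiYau

variable (k : Type v) [Field k] (A : Type u) [Ring A] [Algebra k A]

/-- The enveloping algebra `A^e` of `A`. -/
abbrev EnvelopingAlgebra : Type u := A ⊗[k] Aᵐᵒᵖ

/-- `A` as a left module over its enveloping algebra: `(a ⊗ op b) • x = a * x * b`. -/
noncomputable def envelopingRegular : ModuleCat.{u} (EnvelopingAlgebra k A) :=
  letI : Module (EnvelopingAlgebra k A) A := instModuleTensorProductMop k A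
  ModuleCat.of (EnvelopingAlgebra k A) A

/-- `A` is perfect as a left module over its enveloping algebra. -/
def IsHomologicallySmooth : Prop := IsPerfectModule (envelopingRegular k A)

/-- `Ext^i_{A^e}(A, A^e)`. -/
abbrev EnvelopingExt (i : ℕ) : Type u :=
  Ext.{u} (envelopingRegular k A)
    (ModuleCat.of (EnvelopingAlgebra k A) (EnvelopingAlgebra k A)) i

/-- `A` is twisted Calabi-Yau of dimension `d` over `k`. A bimodule `U` is regarded as a right
`A^e`-module through `u • (a ⊗ op b) = b u a`. -/
def IsTwistedCalabiYau (d : ℕ) : Prop :=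
  IsHomologicallySmooth k A ∧
  (∀ i, i ≠ d → Subsingleton (EnvelopingExt k A i)) ∧
  ∃ U : CentralBimodule k A, U.IsInvertible ∧
    ∃ φ : EnvelopingExt k A d ≃+ U.carrier,
      ∀ (e : EnvelopingExt k A d) (a b : A),
        φ (extRightMul e (a ⊗ₜ[k] op b)) = b • (op a • φ e)

end CalabiYau

/-! Let Ω be the kernel of multiplication A^e → A. Smoothness and the vanishing of Ext^i(A, A^e) for
i ≥ 2 make Ω finitely generated projective. Then U ≅ Ext^1(A, A^e) is Hom(Ω, A^e) modulo
restrictions of right multiplications; `DifferentialDuality` records this.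

For a finite-dimensional left module S, Ext^1_A(S, B) consists of the derivations A → Hom_k(S, B)
modulo inner ones. If B = A·1, the dual basis of Ω embeds the functionals on this space into
Hom_A(U, S), compatibly with A. Since U is invertible, Hom_A(U, S) has no proper nonzero submodule
when S is simple, so Ext^1_A(S, B) has length at most one as a right B-module (`inner_or_top`).

Let J be the preimage in A of the radical of A_0, and B = A/J. Passing from a left ideal to the
kernel of a map onto a simple S killed by J costs Hom_A(-, B) the nonzero part Hom_A(S, B) and gains
at most Ext^1_A(S, B). Starting from Hom_A(A, B) = B, the length of Hom_A(L, B) never exceeds that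
of B, for cofinite L containing a power of J (`length_hom_le`). As B cogenerates A/J-modules, L/JL
has bounded length. By graded Nakayama, a homogeneous left ideal I that is not finitely generated
would give too long a chain above JI, still visible in L = I + A_{≥n}. Leading components reduce
arbitrary left ideals to homogeneous ones. The duality data pass to the opposite algebra, which
gives the other side. -/

/-! ### Homomorphisms from an invertible bimodule to a simple module. -/

section InvertibleHom

variable {k : Type v} [Field k] {A : Type u} [Ring A] [Algebra k A]

/-- The universal balanced pairing `U × V → A` that underlies an isomorphism `U ⊗_A V ≅ A`. -/
structure RegularPairing (U V : CentralBimodule k A) where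
  toFun : U.carrier →ₗ[k] V.carrier →ₗ[k] A
  smul_left : ∀ (a : A) u w, toFun (a • u) w = a * toFun u w
  smul_right : ∀ u w (a : A), toFun u (op a • w) = toFun u w * a
  balanced : ∀ u (a : A) w, toFun (op a • u) w = toFun u (a • w)
  one_mem : (1 : A) ∈ AddSubgroup.closure {x | ∃ u w, toFun u w = x}
  universal : ∀ {X : Type u} [AddCommGroup X] [Module A X] [Module k X] [IsScalarTower k A X]
    (β : U.carrier →ₗ[A] (V.carrier →+ X)), (∀ u (a : A) w, β (op a • u) w = β u (a • w)) →
    ∃ x, ∀ u w, β u w = toFun u w • x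

/-- For `universal`: if t represents 1 in U ⊗ V, then acting by a on its left factor represents a.
Hence a balanced map is determined by its value x at t. -/
theorem TensorIsoRegular.nonempty_regularPairing {U V : CentralBimodule k A}
    (h : TensorIsoRegular U V) : Nonempty (RegularPairing U V) := by
  obtain ⟨φ, hφ⟩ := h
  let p : U.carrier ⊗[k] V.carrier →ₗ[k] A := φ.toLinearMap ∘ₗ (balancedRelations U V).mkQ
  have hp : ∀ (a b : A) (u : U.carrier) (w : V.carrier),
      p ((a • u) ⊗ₜ[k] (op b • w)) = a * p (u ⊗ₜ[k] w) * b := hφ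
  have psurj : Function.Surjective p :=
    φ.surjective.comp (Submodule.mkQ_surjective _)
  refine ⟨{ toFun := TensorProduct.curry p, smul_left := ?_, smul_right := ?_, balanced := ?_,
            one_mem := ?_, universal := ?_ }⟩
  · intro a u w
    simpa using hp a 1 u w
  · intro u w a
    simpa using hp 1 a u w
  · intro u a w
    have : p ((op a • u) ⊗ₜ[k] w - u ⊗ₜ[k] (a • w)) = 0 := by
      have hm : (op a • u) ⊗ₜ[k] w - u ⊗ₜ[k] (a • w) ∈ balancedRelations U V :=
        Submodule.subset_span ⟨u, a, w, rfl⟩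
      have : (balancedRelations U V).mkQ ((op a • u) ⊗ₜ[k] w - u ⊗ₜ[k] (a • w)) = 0 := by
        simpa using (Submodule.Quotient.mk_eq_zero _).2 hm
      change φ _ = 0
      rw [this, map_zero]
    rw [map_sub, sub_eq_zero] at this
    exact this
  · obtain ⟨t, ht⟩ := psurj 1
    have key : ∀ t, p t ∈ AddSubgroup.closure {x | ∃ u w, TensorProduct.curry p u w = x} := by
      intro t
      induction t using TensorProduct.induction_on with
      | zero => simp
      | tmul u w => exact AddSubgroup.subset_closure ⟨u, w, rfl⟩
      | add x y hx hy => rw [map_add]; exact add_mem hx hy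
    exact ht ▸ key t
  · intro X _ _ _ _ β hβ
    have hβl : ∀ (c : k) u w, β (c • u) w = c • β u w := by
      intro c u w
      rw [← algebraMap_smul A c u, map_smul, AddMonoidHom.smul_apply, algebraMap_smul]
    have hβr : ∀ (c : k) u w, β u (c • w) = c • β u w := by
      intro c u w
      rw [← algebraMap_smul A c w, ← hβ, ← hβl, ← algebraMap_smul Aᵐᵒᵖ c u,
        MulOpposite.algebraMap_apply]
    let b : U.carrier ⊗[k] V.carrier →ₗ[k] X := TensorProduct.lift
      (LinearMap.mk₂ k (fun u w => β u w) (by simp) hβl (by simp) hβr)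
    have hb : ∀ u w, b (u ⊗ₜ[k] w) = β u w := fun u w => by simp [b]
    have hker : balancedRelations U V ≤ LinearMap.ker b := by
      refine Submodule.span_le.2 ?_
      rintro _ ⟨u, a, w, rfl⟩
      simp [hb, hβ]
    have hpker : ∀ t t', p t = p t' → b t = b t' := by
      intro t t' htt
      have h1 : t - t' ∈ balancedRelations U V := by
        rw [← Submodule.Quotient.eq]
        exact φ.injective htt
      have h2 := hker h1
      rwa [LinearMap.mem_ker, map_sub, sub_eq_zero] at h2
    let l : A → U.carrier ⊗[k] V.carrier →ₗ[k] U.carrier ⊗[k] V.carrier :=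
      fun a => TensorProduct.map (Module.toModuleEnd k U.carrier a) LinearMap.id
    have hpl : ∀ a t, p (l a t) = a * p t := by
      intro a t
      induction t using TensorProduct.induction_on with
      | zero => simp
      | tmul u w => simpa [l] using hp a 1 u w
      | add x y hx hy => rw [map_add, map_add, hx, hy, map_add, mul_add]
    have hbl : ∀ a t, b (l a t) = a • b t := by
      intro a t
      induction t using TensorProduct.induction_on with
      | zero => simp
      | tmul u w => simp [l, hb]
      | add x y hx hy => rw [map_add, map_add, hx, hy, map_add, smul_add]
    obtain ⟨t, ht⟩ := psurj 1
    refine ⟨b t, fun u w => ?_⟩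
    rw [← hb, TensorProduct.curry_apply, ← hbl]
    exact hpker _ _ (by rw [hpl, ht, mul_one])

/-- Precomposition of a left linear map on a bimodule with the right action of a scalar. -/
def rightTranslate {U : CentralBimodule k A} {S : Type u} [AddCommGroup S] [Module A S] (a : A)
    (f : U.carrier →ₗ[A] S) : U.carrier →ₗ[A] S where
  toFun u := f (op a • u)
  map_add' := by simp
  map_smul' b u := by rw [← smul_comm, map_smul, RingHom.id_apply]

/-- If `U` is invertible and `S` is simple, then the left module `Hom_A(U, S)` has no proper
nonzero submodules. -/
theorem hom_eq_zero_or_top_of_isSimpleModule {U V : CentralBimodule k A}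
    (p : RegularPairing U V) (q : RegularPairing V U)
    {S : Type u} [AddCommGroup S] [Module A S] [Module k S] [IsScalarTower k A S]
    [IsSimpleModule A S]
    (N : AddSubgroup (U.carrier →ₗ[A] S)) (hN : ∀ a, ∀ f ∈ N, rightTranslate a f ∈ N) :
    N = ⊥ ∨ N = ⊤ := by
  -- the functional attached to `w` and `s`
  let F : V.carrier → S → (U.carrier →ₗ[A] S) := fun w s =>
    { toFun := fun u => p.toFun u w • s
      map_add' := by simp [add_smul]
      map_smul' := by simp [p.smul_left, mul_smul] }
  -- The maps `F w s` are the image of V ⊗ S in Hom_A(U, S). X is closed under A because a acting on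
  -- s can be moved to the right action on w.
  let X : Submodule A S :=
    { carrier := {s | ∀ w, F w s ∈ N}
      zero_mem' := fun w => by
        have : F w 0 = 0 := by ext; simp [F]
        rw [this]; exact N.zero_mem
      add_mem' := fun {s t} hs ht w => by
        have : F w (s + t) = F w s + F w t := by ext; simp [F]
        rw [this]; exact N.add_mem (hs w) (ht w)
      smul_mem' := fun a s hs w => by
        have : F w (a • s) = F (op a • w) s := by ext; simp [F, p.smul_right, mul_smul]
        rw [this]; exact hs _ }
  -- For fixed u, the expression f(u' q(w, u)) is balanced in (u', w), so it factors through p with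
  -- one s that serves all w.
  have factor : ∀ (f : U.carrier →ₗ[A] S) (u : U.carrier), ∃ s, ∀ w,
      rightTranslate (q.toFun w u) f = F w s := by
    intro f u
    obtain ⟨s, hs⟩ := p.universal (X := S)
      { toFun := fun u' =>
          { toFun := fun w => f (op (q.toFun w u) • u')
            map_zero' := by simp
            map_add' := by simp [add_smul] }
        map_add' := fun x y => by ext; simp
        map_smul' := fun a x => by ext; simp [← smul_comm a] }
      (fun u' a w => by simp [q.smul_left, mul_smul])
    exact ⟨s, fun w => LinearMap.ext fun u' => hs u' w⟩
  -- Since 1 is a sum of values of q, f is a sum of its translates by such values.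
  have one_expand : ∀ (M : AddSubgroup (U.carrier →ₗ[A] S)) (f : U.carrier →ₗ[A] S),
      (∀ w u, rightTranslate (q.toFun w u) f ∈ M) → f ∈ M := by
    intro M f hf
    have key : ∀ a ∈ AddSubgroup.closure {x | ∃ w u, q.toFun w u = x}, rightTranslate a f ∈ M := by
      intro a ha
      refine AddSubgroup.closure_induction (p := fun a _ => rightTranslate a f ∈ M) ?_ ?_ ?_ ?_ ha
      · rintro _ ⟨w, u, rfl⟩
        exact hf w u
      · have : rightTranslate 0 f = 0 := by ext; simp [rightTranslate]
        rw [this]; exact M.zero_mem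
      · intro x y _ _ hx hy
        have : rightTranslate (x + y) f = rightTranslate x f + rightTranslate y f := by
          ext; simp [rightTranslate, add_smul]
        rw [this]; exact M.add_mem hx hy
      · intro x _ hx
        have : rightTranslate (-x) f = -rightTranslate x f := by
          ext; simp [rightTranslate]
        rw [this]; exact M.neg_mem hx
    have : rightTranslate 1 f = f := by ext; simp [rightTranslate]
    exact this ▸ key 1 q.one_mem
  rcases eq_bot_or_eq_top X with hX | hX
  · left
    refine (AddSubgroup.eq_bot_iff_forall _).2 fun f hf => ?_
    refine AddSubgroup.mem_bot.1 (one_expand ⊥ f fun w u => ?_)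
    obtain ⟨s, hs⟩ := factor f u
    have hsX : s ∈ X := fun w => hs w ▸ hN _ _ hf
    rw [hX, Submodule.mem_bot] at hsX
    rw [hs, hsX, AddSubgroup.mem_bot]
    ext; simp [F]
  · right
    refine eq_top_iff.2 fun f _ => one_expand N f fun w u => ?_
    obtain ⟨s, hs⟩ := factor f u
    have hsX : s ∈ X := hX ▸ Submodule.mem_top
    exact hs w ▸ hsX w

end InvertibleHom

/-! ### Double derivations and the duality data. -/

section Duality

variable (k : Type v) [Field k] (A : Type u) [Ring A] [Algebra k A]

/-- The multiplication map `A ⊗ Aᵐᵒᵖ → A`. -/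
noncomputable def mulOpMap : A ⊗[k] Aᵐᵒᵖ →ₗ[k] A :=
  LinearMap.mul' k A ∘ₗ TensorProduct.map LinearMap.id (opLinearEquiv k).symm.toLinearMap

@[simp]
theorem mulOpMap_tmul (a : A) (b : Aᵐᵒᵖ) : mulOpMap k A (a ⊗ₜ b) = a * b.unop := by
  simp [mulOpMap]

/-- The universal derivation `a ↦ 1 ⊗ a - a ⊗ 1`. -/
noncomputable def univDer : A →ₗ[k] A ⊗[k] Aᵐᵒᵖ :=
  TensorProduct.mk k A Aᵐᵒᵖ 1 ∘ₗ (opLinearEquiv k).toLinearMap -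
    (TensorProduct.mk k A Aᵐᵒᵖ).flip 1

@[simp]
theorem univDer_apply (a : A) : univDer k A a = 1 ⊗ₜ op a - a ⊗ₜ 1 := by
  simp [univDer]

/-- The bimodule of noncommutative differentials of `A` has a finite dual basis, and an invertible
bimodule `U` is a quotient of its dual by the inner elements, as for a twisted Calabi-Yau algebra of
dimension one. -/
structure DifferentialDuality where
  U : CentralBimodule k A
  V : CentralBimodule k A
  left : TensorIsoRegular U V
  right : TensorIsoRegular V U
  H : Type u
  [addCommGroup : AddCommGroup H]
  toDer : H →+ (A →ₗ[k] A ⊗[k] Aᵐᵒᵖ)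
  toU : H →+ U.carrier
  toU_surjective : Function.Surjective toU
  exists_mul_right : ∀ h (a b : A), ∃ h', (∀ c, toDer h' c = toDer h c * (a ⊗ₜ op b)) ∧
    toU h' = b • (op a • toU h)
  inner : ∀ h, toU h = 0 → ∃ r, ∀ c, toDer h c = univDer k A c * r
  n : ℕ
  form : Fin n → A ⊗[k] Aᵐᵒᵖ
  dual : Fin n → H
  mulOpMap_form : ∀ i, mulOpMap k A (form i) = 0
  dual_basis : ∀ a, univDer k A a = ∑ i, toDer (dual i) a * form i

attribute [instance] DifferentialDuality.addCommGroup

end Duality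

/-! ### Derivations into Hom_k(S, B) as maps on noncommutative differentials. -/

section Action

variable (k : Type v) [Field k] {A : Type u} [Ring A] [Algebra k A]
variable (S : Type u) [AddCommGroup S] [Module A S] [Module k S] [IsScalarTower k A S]
variable (B : Type u) [AddCommGroup B] [Module k B] [Module A B] [IsScalarTower k A B]

/-- The action of the enveloping algebra on `Hom_k(S, B)` for left modules `S` and `B`. -/
noncomputable def homAction : A ⊗[k] Aᵐᵒᵖ →ₐ[k] Module.End k (S →ₗ[k] B) :=
  Algebra.TensorProduct.lift (Algebra.lsmul k k (S →ₗ[k] B))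
    { toFun := fun b => LinearMap.lcomp k B (Algebra.lsmul k k S b.unop)
      map_one' := by ext; simp
      map_mul' := fun x y => by ext; simp
      map_zero' := by ext; simp
      map_add' := fun x y => by ext; simp
      commutes' := fun c => by ext; simp }
    (fun a b => by rw [commute_iff_eq]; ext; simp)

variable {S B}

@[simp]
theorem homAction_tmul (a : A) (b : Aᵐᵒᵖ) (m : S →ₗ[k] B) (s : S) :
    homAction k S B (a ⊗ₜ b) m s = a • m (b.unop • s) := by
  rw [homAction, Algebra.TensorProduct.lift_tmul]
  rfl

/-- The extension of a derivation `δ : A → Hom_k(S, B)` to `A ⊗ Aᵐᵒᵖ` by `x ⊗ y ↦ x δ(y)`. -/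
noncomputable def derExt (δ : A →ₗ[k] S →ₗ[k] B) : A ⊗[k] Aᵐᵒᵖ →ₗ[k] S →ₗ[k] B :=
  TensorProduct.lift
    ((Algebra.lsmul k k (S →ₗ[k] B)).toLinearMap.compl₂ (δ ∘ₗ (opLinearEquiv k).symm.toLinearMap))

@[simp]
theorem derExt_tmul (δ : A →ₗ[k] S →ₗ[k] B) (a : A) (b : Aᵐᵒᵖ) :
    derExt k δ (a ⊗ₜ b) = a • δ b.unop := by
  simp [derExt]

variable {k}

/-- The derivations `A → Hom_k(S, B)`. -/
def IsHomDerivation (δ : A →ₗ[k] S →ₗ[k] B) : Prop :=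
  ∀ a b s, δ (a * b) s = a • δ b s + δ a (b • s)

/-- On all of A^e, `derExt` fails to be linear by the term (a μ(w)) δ(b), with μ the multiplication;
this term vanishes on the kernel of μ. -/
theorem IsHomDerivation.derExt_mul {δ : A →ₗ[k] S →ₗ[k] B} (hδ : IsHomDerivation δ)
    (r w : A ⊗[k] Aᵐᵒᵖ) (hw : mulOpMap k A w = 0) :
    derExt k δ (r * w) = homAction k S B r (derExt k δ w) := by
  have key : ∀ (a : A) (b : Aᵐᵒᵖ) (w : A ⊗[k] Aᵐᵒᵖ), derExt k δ ((a ⊗ₜ b) * w) =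
      (a * mulOpMap k A w) • δ b.unop + homAction k S B (a ⊗ₜ b) (derExt k δ w) := by
    intro a b w
    induction w using TensorProduct.induction_on with
    | zero => simp
    | tmul x y =>
      ext s
      simp [hδ y.unop b.unop, mul_smul]
    | add x y hx hy =>
      rw [mul_add, map_add, hx, hy, map_add, map_add, map_add, mul_add, add_smul]
      abel
  induction r using TensorProduct.induction_on with
  | zero => simp
  | tmul a b => rw [key, hw, mul_zero, zero_smul, zero_add]
  | add x y hx hy => rw [add_mul, map_add, hx, hy, map_add, LinearMap.add_apply]

theorem IsHomDerivation.derExt_univDer {δ : A →ₗ[k] S →ₗ[k] B} (hδ : IsHomDerivation δ) (a : A) :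
    derExt k δ (univDer k A a) = δ a := by
  have h1 : δ 1 = 0 := by
    ext s
    have := hδ 1 1 s
    simpa using this
  simp [h1]

theorem IsHomDerivation.eq_sum (D : DifferentialDuality k A) {δ : A →ₗ[k] S →ₗ[k] B}
    (hδ : IsHomDerivation δ) (a : A) :
    δ a = ∑ i, homAction k S B (D.toDer (D.dual i) a) (derExt k δ (D.form i)) := by
  rw [← hδ.derExt_univDer a, D.dual_basis, map_sum]
  exact Finset.sum_congr rfl fun i _ => hδ.derExt_mul _ _ (D.mulOpMap_form i)

end Action

/-! ### Duality between Ext^1_A(S, B) and Hom_A(U, S). -/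

section Dichotomy

variable {k : Type v} [Field k] {A : Type u} [Ring A] [Algebra k A]
variable {S : Type u} [AddCommGroup S] [Module A S] [Module k S] [IsScalarTower k A S]
variable {B : Type u} [Ring B] [Algebra k B] [Module A B] [IsScalarTower k A B]

variable (k A S B) in
/-- The inner derivation attached to an element of `Hom_k(S, B)`. -/
noncomputable def innerDer : (S →ₗ[k] B) →ₗ[k] A →ₗ[k] S →ₗ[k] B :=
  ((homAction (A := A) k S B).toLinearMap ∘ₗ univDer k A).flip

theorem innerDer_apply (m : S →ₗ[k] B) (a : A) (s : S) :
    innerDer k A S B m a s = m (a • s) - a • m s := by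
  simp [innerDer]

variable (k S B) in
/-- The rank one map `s ↦ σ(s) 1`. -/
noncomputable def rankOne : Module.Dual k S →ₗ[k] S →ₗ[k] B :=
  LinearMap.smulRightₗ.flip 1

@[simp]
theorem rankOne_apply (σ : Module.Dual k S) (s : S) : rankOne k S B σ s = σ s • (1 : B) := by
  simp [rankOne]

namespace DifferentialDuality

variable (D : DifferentialDuality k A)

variable (S B) in
/-- The derivation `A → Hom_k(S, B)` that a double derivation and an element of `Hom_k(S, B)`
define. -/
noncomputable def contract (h : D.H) : (S →ₗ[k] B) →ₗ[k] A →ₗ[k] S →ₗ[k] B :=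
  ((homAction (A := A) k S B).toLinearMap ∘ₗ D.toDer h).flip

theorem contract_apply (h : D.H) (m : S →ₗ[k] B) (a : A) :
    D.contract S B h m a = homAction k S B (D.toDer h a) m := by
  simp [contract]

theorem contract_mul_right {h h' : D.H} {r : A ⊗[k] Aᵐᵒᵖ}
    (hr : ∀ c, D.toDer h' c = D.toDer h c * r) (m : S →ₗ[k] B) :
    D.contract S B h' m = D.contract S B h (homAction k S B r m) := by
  ext a s
  simp [contract_apply, hr]

theorem contract_of_toU_eq_zero {h : D.H} (hh : D.toU h = 0) (m : S →ₗ[k] B) :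
    ∃ m', D.contract S B h m = innerDer k A S B m' := by
  obtain ⟨r, hr⟩ := D.inner h hh
  refine ⟨homAction k S B r m, ?_⟩
  ext a s
  rw [contract_apply, hr, map_mul, Module.End.mul_apply, innerDer_apply]
  simp

/-- For fixed h the right side is a functional of σ, hence evaluation at a vector of the
finite-dimensional S. As l kills inner derivations, this vector depends only on `toU h`. -/
theorem exists_hom_of_dual [FiniteDimensional k S] (l : Module.Dual k (A →ₗ[k] S →ₗ[k] B))
    (hl : ∀ m, l (innerDer k A S B m) = 0) :
    ∃ f : D.U.carrier →ₗ[A] S, ∀ h σ, σ (f (D.toU h)) = l (D.contract S B h (rankOne k S B σ)) := by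
  let val : D.H → S := fun h =>
    (Module.evalEquiv k S).symm (l ∘ₗ D.contract S B h ∘ₗ rankOne k S B)
  have hval : ∀ h σ, σ (val h) = l (D.contract S B h (rankOne k S B σ)) := fun h σ => by
    simp [val, Module.apply_evalEquiv_symm_apply]
  have sep : ∀ s t : S, (∀ σ : Module.Dual k S, σ s = σ t) → s = t := fun s t hst => by
    rw [← sub_eq_zero]
    refine (Module.forall_dual_apply_eq_zero_iff k _).1 fun σ => ?_
    rw [map_sub, hst, sub_self]
  have val_add : ∀ h h', val (h + h') = val h + val h' := fun h h' => sep _ _ fun σ => by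
    have : D.contract S B (h + h') = D.contract S B h + D.contract S B h' := by
      ext; simp [contract_apply]
    rw [map_add, hval, hval, hval, this, LinearMap.add_apply, map_add]
  have val_zero : ∀ h, D.toU h = 0 → val h = 0 := fun h hh => sep _ _ fun σ => by
    obtain ⟨m, hm⟩ := D.contract_of_toU_eq_zero hh (rankOne k S B σ)
    rw [hval, hm, hl, map_zero]
  have val_congr : ∀ h h', D.toU h = D.toU h' → val h = val h' := fun h h' hh => by
    have h1 := val_add (h - h') h'
    rwa [sub_add_cancel, val_zero (h - h') (by rw [map_sub, hh, sub_self]), zero_add] at h1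
  let g := Function.surjInv D.toU_surjective
  have hg : ∀ u, D.toU (g u) = u := Function.surjInv_eq _
  refine ⟨{ toFun := fun u => val (g u), map_add' := fun u v => ?_, map_smul' := fun b u => ?_ },
    fun h σ => ?_⟩
  · rw [← val_add]
    exact val_congr _ _ (by rw [map_add, hg, hg, hg])
  · obtain ⟨h', hh', hu⟩ := D.exists_mul_right (g u) 1 b
    rw [RingHom.id_apply, val_congr (g (b • u)) h' (by rw [hg, hu, op_one, one_smul, hg])]
    refine sep _ _ fun σ => ?_
    have h1 : homAction k S B ((1 : A) ⊗ₜ op b) (rankOne k S B σ) =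
        rankOne k S B (σ ∘ₗ Algebra.lsmul k k S b) := by
      ext s; simp
    rw [hval, D.contract_mul_right hh', h1, ← hval]
    rfl
  · rw [← hval]
    exact congrArg σ (val_congr _ _ (hg _))

theorem _root_.exists_sum_homAction_rankOne [FiniteDimensional k S]
    (hB : ∀ b : B, ∃ a : A, a • (1 : B) = b) (m : S →ₗ[k] B) :
    ∃ (n : ℕ) (c : Fin n → A) (σ : Fin n → Module.Dual k S),
      m = ∑ j, homAction k S B (c j ⊗ₜ 1) (rankOne k S B (σ j)) := by
  let e := Module.finBasis k S
  choose c hc using fun j => hB (m (e j))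
  refine ⟨_, c, e.coord, e.ext fun i => ?_⟩
  rw [LinearMap.sum_apply, Finset.sum_eq_single i]
  · simp [hc]
  · intro j _ hj
    simp [Finsupp.single_eq_of_ne hj]
  · simp

/-- This is the injectivity of l ↦ f on functionals restricted to derivations: rank one maps
generate Hom_k(S, B) under A, and the dual basis writes each derivation as a sum of contractions. -/
theorem dual_eq_zero_of_isHomDerivation [FiniteDimensional k S]
    (hB : ∀ b : B, ∃ a : A, a • (1 : B) = b) (l : Module.Dual k (A →ₗ[k] S →ₗ[k] B))
    (hl : ∀ h σ, l (D.contract S B h (rankOne k S B σ)) = 0)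
    {δ : A →ₗ[k] S →ₗ[k] B} (hδ : IsHomDerivation δ) : l δ = 0 := by
  have h1 : ∀ h m, l (D.contract S B h m) = 0 := by
    intro h m
    obtain ⟨n, c, σ, rfl⟩ := exists_sum_homAction_rankOne hB m
    rw [map_sum, map_sum]
    refine Finset.sum_eq_zero fun j _ => ?_
    obtain ⟨h', hh', -⟩ := D.exists_mul_right h (c j) 1
    rw [op_one] at hh'
    rw [← D.contract_mul_right hh', hl]
  have h2 : δ = ∑ i, D.contract S B (D.dual i) (derExt k δ (D.form i)) := by
    refine LinearMap.ext fun a => ?_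
    rw [hδ.eq_sum D, LinearMap.sum_apply]
    exact Finset.sum_congr rfl fun i _ => (D.contract_apply _ _ _).symm
  rw [h2, map_sum]
  exact Finset.sum_eq_zero fun i _ => h1 _ _

variable [SMulCommClass A Bᵐᵒᵖ B]

theorem _root_.homAction_op_smul (r : A ⊗[k] Aᵐᵒᵖ) (b : Bᵐᵒᵖ) (m : S →ₗ[k] B) :
    homAction k S B r (b • m) = b • homAction k S B r m := by
  induction r using TensorProduct.induction_on with
  | zero => simp
  | tmul x y =>
    ext s
    rw [homAction_tmul, LinearMap.smul_apply, LinearMap.smul_apply, homAction_tmul, smul_comm]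
  | add x y hx hy => rw [map_add, LinearMap.add_apply, hx, hy, LinearMap.add_apply, smul_add]

/-- For a simple module `S`, the first Hochschild cohomology of `A` with values in `Hom_k(S, B)` is
a simple right module or zero. -/
theorem inner_or_top (D : DifferentialDuality k A) [FiniteDimensional k S] [IsSimpleModule A S]
    (hB : ∀ b : B, ∃ a : A, a • (1 : B) = b)
    (Z : Submodule Bᵐᵒᵖ (A →ₗ[k] S →ₗ[k] B)) (inner_mem : ∀ m, innerDer k A S B m ∈ Z)
    (hZ : ∀ δ ∈ Z, IsHomDerivation δ) :
    (∀ δ ∈ Z, δ ∈ LinearMap.range (innerDer k A S B)) ∨ ∀ δ, IsHomDerivation δ → δ ∈ Z := by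
  obtain ⟨p⟩ := D.left.nonempty_regularPairing
  obtain ⟨q⟩ := D.right.nonempty_regularPairing
  -- N is the annihilator of Z, transported into Hom_A(U, S).
  let N : AddSubgroup (D.U.carrier →ₗ[A] S) :=
    { carrier := {f | ∃ l : Module.Dual k (A →ₗ[k] S →ₗ[k] B), (∀ δ ∈ Z, l δ = 0) ∧
        ∀ h σ, σ (f (D.toU h)) = l (D.contract S B h (rankOne k S B σ))}
      zero_mem' := ⟨0, by simp, by simp⟩
      add_mem' := by
        rintro f g ⟨l, hl, hf⟩ ⟨l', hl', hg⟩
        exact ⟨l + l', fun δ hδ => by simp [hl δ hδ, hl' δ hδ], fun h σ => by simp [hf, hg]⟩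
      neg_mem' := by
        rintro f ⟨l, hl, hf⟩
        exact ⟨-l, fun δ hδ => by simp [hl δ hδ], fun h σ => by simp [hf]⟩ }
  have hN : ∀ a, ∀ f ∈ N, rightTranslate a f ∈ N := by
    rintro a f ⟨l, hl, hf⟩
    -- Translating f by a corresponds to precomposing l with right multiplication by `a • 1`, which
    -- preserves Z.
    refine ⟨l ∘ₗ (DistribSMul.toLinearMap k _ (op (a • (1 : B)))),
      fun δ hδ => hl _ (Z.smul_mem _ hδ), fun h σ => ?_⟩
    obtain ⟨h', hh', hu⟩ := D.exists_mul_right h a 1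
    rw [one_smul] at hu
    change σ (f (op a • D.toU h)) = l (op (a • (1 : B)) • D.contract S B h (rankOne k S B σ))
    rw [← hu, hf, D.contract_mul_right hh']
    have h1 : homAction k S B (a ⊗ₜ op 1) (rankOne k S B σ) =
        op (a • (1 : B)) • rankOne k S B σ := by
      ext s
      rw [homAction_tmul, LinearMap.smul_apply, rankOne_apply, rankOne_apply, smul_comm,
        unop_op, one_smul, ← smul_comm (σ s), op_smul_eq_mul, one_mul]
    rw [h1]
    congr 1
    ext c : 1
    rw [LinearMap.smul_apply, contract_apply, contract_apply, homAction_op_smul]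
  have sep : ∀ (W : Submodule k (A →ₗ[k] S →ₗ[k] B)) δ,
      (∀ l : Module.Dual k (A →ₗ[k] S →ₗ[k] B), (∀ w ∈ W, l w = 0) → l δ = 0) → δ ∈ W := by
    intro W δ h
    by_contra hδ
    obtain ⟨l, hl, hW⟩ := Submodule.exists_dual_map_eq_bot_of_notMem (R := k)
      (M := A →ₗ[k] S →ₗ[k] B) (p := W) hδ inferInstance
    rw [← LinearMap.le_ker_iff_map] at hW
    exact hl (h l fun w hw => hW hw)
  -- If N = 0, functionals that kill Z kill all derivations. If N is everything, a functional
  -- killing inner derivations agrees on all derivations with one killing Z.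
  rcases hom_eq_zero_or_top_of_isSimpleModule (k := k) p q N hN with h | h
  · right
    intro δ hδ
    refine sep (Z.restrictScalars k) δ fun l hl => ?_
    obtain ⟨f, hf⟩ := D.exists_hom_of_dual l fun m => hl _ (inner_mem m)
    have hfN : f ∈ N := ⟨l, hl, hf⟩
    rw [h, AddSubgroup.mem_bot] at hfN
    refine D.dual_eq_zero_of_isHomDerivation hB l (fun h σ => ?_) hδ
    rw [← hf, hfN, LinearMap.zero_apply, map_zero]
  · left
    intro δ hδ
    refine sep _ δ fun l hl => ?_
    obtain ⟨f, hf⟩ := D.exists_hom_of_dual l fun m => hl _ ⟨m, rfl⟩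
    obtain ⟨l', hl', hf'⟩ : f ∈ N := h ▸ AddSubgroup.mem_top f
    have := D.dual_eq_zero_of_isHomDerivation hB (l - l')
      (fun h σ => by rw [LinearMap.sub_apply, ← hf, ← hf', sub_self]) (hZ δ hδ)
    rwa [LinearMap.sub_apply, hl' δ hδ, sub_zero] at this

end DifferentialDuality

end Dichotomy

/-! ### Comparison of Hom_A(L, B) with Hom_A(ker q, B). -/

section HomLength

variable {k : Type v} [Field k] {A : Type u} [Ring A] [Algebra k A]

theorem Module.length_le_one_of_forall {R M : Type*} [Ring R] [AddCommGroup M] [Module R M]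
    (h : ∀ N : Submodule R M, N = ⊥ ∨ N = ⊤) : Module.length R M ≤ 1 := by
  cases subsingleton_or_nontrivial M
  · simp [Module.length_eq_zero]
  · have : IsSimpleOrder (Submodule R M) := ⟨h⟩
    have : IsSimpleModule R M := { }
    exact (Module.length_eq_one R M).le

variable {S : Type u} [AddCommGroup S] [Module A S] [Module k S] [IsScalarTower k A S]
variable {B : Type u} [Ring B] [Algebra k B] [Module A B] [IsScalarTower k A B]
  [SMulCommClass A Bᵐᵒᵖ B]

theorem innerDer_op_smul (b : Bᵐᵒᵖ) (m : S →ₗ[k] B) :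
    innerDer k A S B (b • m) = b • innerDer k A S B m := by
  ext a s
  simp only [innerDer_apply, LinearMap.smul_apply, smul_sub]
  rw [smul_comm]

variable {L : Type u} [AddCommGroup L] [Module A L] [Module k L] [IsScalarTower k A L]

/-- The cocycle `(a, t) ↦ a s(t) - s(a t)` of a `k`-linear section `s` of `q`. -/
noncomputable def sectionCocycle (q : L →ₗ[A] S) (s : S →ₗ[k] L) (hs : ∀ t, q (s t) = t) :
    A →ₗ[k] S →ₗ[k] LinearMap.ker q :=
  LinearMap.mk₂ k (fun a t => ⟨a • s t - s (a • t), by simp [hs]⟩)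
    (fun a b t => by ext; simp [add_smul]; abel)
    (fun c a t => by ext; simp [smul_sub])
    (fun a t t' => by ext; simp; abel)
    (fun c a t => by
      ext
      change a • s (c • t) - s (a • c • t) = c • (a • s t - s (a • t))
      rw [map_smul, smul_comm a c t, map_smul, smul_sub, smul_comm a c])

@[simp]
theorem coe_sectionCocycle (q : L →ₗ[A] S) (s : S →ₗ[k] L) (hs : ∀ t, q (s t) = t) (a : A) (t : S) :
    (sectionCocycle q s hs a t : L) = a • s t - s (a • t) := rfl

/-- The derivation that obstructs the extension of a linear map on `ker q`. -/
noncomputable def obstruction (q : L →ₗ[A] S) (s : S →ₗ[k] L) (hs : ∀ t, q (s t) = t) :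
    (LinearMap.ker q →ₗ[A] B) →ₗ[Bᵐᵒᵖ] A →ₗ[k] S →ₗ[k] B where
  toFun g := (sectionCocycle q s hs).compr₂ (g.restrictScalars k)
  map_add' g g' := by ext; simp
  map_smul' b g := by ext; simp

theorem obstruction_apply (q : L →ₗ[A] S) (s : S →ₗ[k] L) (hs : ∀ t, q (s t) = t)
    (g : LinearMap.ker q →ₗ[A] B) (a : A) (t : S) :
    obstruction q s hs g a t = g (sectionCocycle q s hs a t) := rfl

theorem isHomDerivation_obstruction (q : L →ₗ[A] S) (s : S →ₗ[k] L) (hs : ∀ t, q (s t) = t)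
    (g : LinearMap.ker q →ₗ[A] B) : IsHomDerivation (obstruction q s hs g) := by
  intro a b t
  rw [obstruction_apply, obstruction_apply, obstruction_apply, ← map_smul, ← map_add]
  congr 1
  ext
  simp [mul_smul, smul_sub]

/-- The naive k-linear extension g(x − s(q x)) fails to be A-linear exactly by the obstruction;
subtracting m(q x) repairs it. -/
theorem exists_extension_of_obstruction (q : L →ₗ[A] S) (s : S →ₗ[k] L) (hs : ∀ t, q (s t) = t)
    (g : LinearMap.ker q →ₗ[A] B) (hg : obstruction q s hs g ∈ LinearMap.range (innerDer k A S B)) :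
    ∃ G : L →ₗ[A] B, ∀ x : LinearMap.ker q, G x = g x := by
  obtain ⟨m, hm⟩ := hg
  let pr : L → LinearMap.ker q := fun x => ⟨x - s (q x), by simp [hs]⟩
  refine ⟨{ toFun := fun x => g (pr x) - m (q x), map_add' := fun x y => ?_,
            map_smul' := fun a x => ?_ }, fun x => ?_⟩
  · have : pr (x + y) = pr x + pr y := by ext; simp [pr]; abel
    rw [this, map_add, map_add, map_add]
    abel
  · have h1 : pr (a • x) = a • pr x + sectionCocycle q s hs a (q x) := by
      ext; simp [pr, smul_sub]
    have h2 := LinearMap.congr_fun (LinearMap.congr_fun hm a) (q x)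
    rw [innerDer_apply, obstruction_apply] at h2
    rw [h1, map_add, ← h2, map_smul g, map_smul q, RingHom.id_apply, smul_sub]
    abel
  · have h1 : pr x = x := by
      ext; simp [pr, LinearMap.mem_ker.1 x.2]
    simp [h1, LinearMap.mem_ker.1 x.2]

/-- The length of `Hom_A(-, B)` does not grow when a simple quotient is cut off. -/
theorem DifferentialDuality.length_hom_ker_le (D : DifferentialDuality k A)
    [FiniteDimensional k S] [IsSimpleModule A S]
    (hB : ∀ b : B, ∃ a : A, a • (1 : B) = b) (q : L →ₗ[A] S) (hq : Function.Surjective q)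
    (hS : ∃ f : S →ₗ[A] B, f ≠ 0) :
    Module.length Bᵐᵒᵖ (LinearMap.ker q →ₗ[A] B) ≤ Module.length Bᵐᵒᵖ (L →ₗ[A] B) := by
  obtain ⟨s, hs'⟩ := (q.restrictScalars k).exists_rightInverse_of_surjective
    (LinearMap.range_eq_top.2 hq)
  have hs : ∀ t, q (s t) = t := fun t => LinearMap.congr_fun hs' t
  let res : (L →ₗ[A] B) →ₗ[Bᵐᵒᵖ] (LinearMap.ker q →ₗ[A] B) :=
    { toFun := fun g => g ∘ₗ (LinearMap.ker q).subtype
      map_add' := fun _ _ => rfl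
      map_smul' := fun _ _ => rfl }
  let I : Submodule Bᵐᵒᵖ (A →ₗ[k] S →ₗ[k] B) :=
    { carrier := LinearMap.range (innerDer k A S B)
      zero_mem' := zero_mem _
      add_mem' := fun h h' => add_mem h h'
      smul_mem' := by
        rintro b _ ⟨m, rfl⟩
        exact ⟨b • m, innerDer_op_smul b m⟩ }
  let Ψ : (LinearMap.ker q →ₗ[A] B) →ₗ[Bᵐᵒᵖ] A →ₗ[k] S →ₗ[k] B := obstruction q s hs
  have hI : ∀ g, Ψ g ∈ I → g ∈ LinearMap.range res := fun g hg => by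
    obtain ⟨G, hG⟩ := exists_extension_of_obstruction q s hs g hg
    exact ⟨G, LinearMap.ext hG⟩
  have inner_der : ∀ δ ∈ I, IsHomDerivation δ := by
    rintro _ ⟨m, rfl⟩ a b t
    simp [innerDer_apply, mul_smul, smul_sub]
  -- The cokernel of restriction embeds into Ext^1_A(S, B) through `Ψ`, so the dichotomy, applied to
  -- I + Ψ(Z'), leaves no intermediate submodule.
  have hcoker : Module.length Bᵐᵒᵖ ((LinearMap.ker q →ₗ[A] B) ⧸ LinearMap.range res) ≤ 1 := by
    refine Module.length_le_one_of_forall fun N => ?_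
    let Z' := N.comap (LinearMap.range res).mkQ
    have hresZ : LinearMap.range res ≤ Z' := fun g hg => by
      have : (LinearMap.range res).mkQ g = 0 := (Submodule.Quotient.mk_eq_zero _).2 hg
      change (LinearMap.range res).mkQ g ∈ N
      rw [this]; exact N.zero_mem
    have hN : N = Z'.map (LinearMap.range res).mkQ :=
      (Submodule.map_comap_eq_of_surjective (Submodule.mkQ_surjective _) N).symm
    rcases D.inner_or_top hB (I ⊔ Z'.map Ψ) (fun m => Submodule.mem_sup_left ⟨m, rfl⟩) (by
      intro δ hδ
      obtain ⟨x, hx, y, ⟨z, -, rfl⟩, rfl⟩ := Submodule.mem_sup.1 hδ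
      have h1 := inner_der x hx
      have h2 := isHomDerivation_obstruction q s hs z
      intro a b t
      simp only [LinearMap.add_apply, h1 a b t, Ψ, h2 a b t, smul_add]
      abel) with h | h
    · left
      rw [hN, eq_bot_iff, Submodule.map_le_iff_le_comap]
      intro g hg
      have : g ∈ LinearMap.range res :=
        hI g (h _ (Submodule.mem_sup_right (Submodule.mem_map_of_mem hg)))
      exact (Submodule.Quotient.mk_eq_zero _).2 this
    · right
      rw [hN, eq_top_iff]
      rintro x -
      obtain ⟨g, rfl⟩ := Submodule.mkQ_surjective _ x
      obtain ⟨x, hx, y, ⟨z, hz, rfl⟩, hxy⟩ := Submodule.mem_sup.1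
        (h (Ψ g) (isHomDerivation_obstruction q s hs g))
      have h1 : g - z ∈ LinearMap.range res := hI _ (by
        rw [map_sub, sub_eq_of_eq_add hxy.symm]; exact hx)
      refine Submodule.mem_map_of_mem ?_
      simpa using Z'.add_mem (hresZ h1) hz
  -- Nonzero maps S → B, composed with q, restrict to zero on ker q.
  have hker : 1 ≤ Module.length Bᵐᵒᵖ (LinearMap.ker res) := by
    obtain ⟨f, hf⟩ := hS
    have : Nontrivial (LinearMap.ker res) := by
      refine ⟨⟨f ∘ₗ q, LinearMap.ext fun x => ?_⟩, 0, fun h => hf (LinearMap.ext fun t => ?_)⟩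
      · simp [res, LinearMap.mem_ker.1 x.2]
      · obtain ⟨x, rfl⟩ := hq t
        exact LinearMap.congr_fun (congrArg Subtype.val h) x
    exact Order.one_le_iff_pos.2 Module.length_pos
  have e1 : Module.length Bᵐᵒᵖ (L →ₗ[A] B) = Module.length Bᵐᵒᵖ (LinearMap.ker res) +
      Module.length Bᵐᵒᵖ (LinearMap.range res) :=
    Module.length_eq_add_of_exact (R := Bᵐᵒᵖ) (N := LinearMap.ker res) (M := L →ₗ[A] B)
      (P := LinearMap.range res) (LinearMap.ker res).subtype res.rangeRestrict
      (Submodule.subtype_injective _) res.surjective_rangeRestrict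
      (LinearMap.exact_iff.2 (by rw [LinearMap.ker_rangeRestrict, Submodule.range_subtype]))
  have e2 : Module.length Bᵐᵒᵖ (LinearMap.ker q →ₗ[A] B) =
      Module.length Bᵐᵒᵖ (LinearMap.range res) +
      Module.length Bᵐᵒᵖ ((LinearMap.ker q →ₗ[A] B) ⧸ LinearMap.range res) :=
    Module.length_eq_add_of_exact (R := Bᵐᵒᵖ) (N := LinearMap.range res)
    (M := LinearMap.ker q →ₗ[A] B) (P := (LinearMap.ker q →ₗ[A] B) ⧸ LinearMap.range res)
    (LinearMap.range res).subtype (LinearMap.range res).mkQ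
    (Submodule.subtype_injective _) (Submodule.mkQ_surjective _)
    (LinearMap.exact_iff.2 (by rw [Submodule.ker_mkQ, Submodule.range_subtype]))
  rw [e1, e2, add_comm]
  exact add_le_add (hcoker.trans hker) le_rfl

end HomLength

/-! ### The semisimple quotient B as a cogenerator. -/

section Cogenerator

variable {k : Type v} [Field k] {A : Type u} [Ring A] [Algebra k A]
variable (A) (B : Type u) [Ring B] [Module A B]

/-- The annihilator of `1 : B` in `A`. -/
def oneAnnihilator : Ideal A := LinearMap.ker (LinearMap.toSpanSingleton A B (1 : B))

variable {A B}

@[simp]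
theorem mem_oneAnnihilator {a : A} : a ∈ oneAnnihilator A B ↔ a • (1 : B) = 0 := by
  simp [oneAnnihilator]

theorem isTwoSided_oneAnnihilator [SMulCommClass A Bᵐᵒᵖ B] : (oneAnnihilator A B).IsTwoSided := by
  refine ⟨fun {a} b ha => ?_⟩
  rw [mem_oneAnnihilator] at ha ⊢
  have h1 : a • (op (b • (1 : B)) • (1 : B)) = op (b • (1 : B)) • (a • (1 : B)) := smul_comm _ _ _
  rw [ha, smul_zero, op_smul_eq_mul, one_mul] at h1
  rw [mul_smul, h1]

variable {V : Type u} [AddCommGroup V] [Module A V]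

theorem exists_orbit_map (hB : ∀ b : B, ∃ a : A, a • (1 : B) = b)
    (hV : ∀ a ∈ oneAnnihilator A B, ∀ x : V, a • x = 0) (v : V) :
    ∃ r : B →ₗ[A] V, r 1 = v := by
  let t := LinearMap.toSpanSingleton A B (1 : B)
  have ht : Function.Surjective t := fun b => by simpa [t] using hB b
  let e := t.quotKerEquivOfSurjective ht
  refine ⟨((LinearMap.ker t).liftQ (LinearMap.toSpanSingleton A V v) fun a ha => by
    simpa using hV a ha v) ∘ₗ e.symm.toLinearMap, ?_⟩
  have : e.symm 1 = (LinearMap.ker t).mkQ 1 := by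
    rw [LinearEquiv.symm_apply_eq]
    simp [e, t]
  simp [this]

/-- V is a sum of images of B, hence semisimple. The orbit map B → A v splits; the splitting is
injective and extends to V. -/
theorem exists_hom_apply_ne_zero [IsSemisimpleModule A B] (hB : ∀ b : B, ∃ a : A, a • (1 : B) = b)
    (hV : ∀ a ∈ oneAnnihilator A B, ∀ x : V, a • x = 0) {v : V} (hv : v ≠ 0) :
    ∃ f : V →ₗ[A] B, f v ≠ 0 := by
  choose r hr using fun v : V => exists_orbit_map hB hV v
  have : IsSemisimpleModule A V := by
    refine isSemisimpleModule_of_isSemisimpleModule_submodule' (p := fun v => LinearMap.range (r v))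
      (fun v => IsSemisimpleModule.range (r v)) (eq_top_iff.2 fun v _ => ?_)
    exact (le_iSup (fun v => LinearMap.range (r v)) v) ⟨1, hr v⟩
  obtain ⟨h, hh⟩ := IsSemisimpleModule.lifting_property (r v).rangeRestrict
    (r v).surjective_rangeRestrict LinearMap.id
  obtain ⟨g, hg⟩ := IsSemisimpleModule.extension_property (LinearMap.range (r v)).subtype
    (Submodule.subtype_injective _) h
  refine ⟨g, fun h0 => hv ?_⟩
  have h1 : g v = h ⟨v, 1, hr v⟩ := by rw [← hg]; rfl
  rw [h0] at h1
  have h2 := LinearMap.congr_fun hh ⟨v, 1, hr v⟩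
  rw [LinearMap.comp_apply, ← h1, map_zero] at h2
  exact (congrArg Subtype.val h2).symm

variable [SMulCommClass A Bᵐᵒᵖ B]

/-- The length of a chain of submodules above `J L`, with `J` the annihilator of `B`, is bounded by
the length of `Hom_A(L, B)`. -/
theorem le_length_hom_of_strictMono [IsSemisimpleModule A B]
    (hB : ∀ b : B, ∃ a : A, a • (1 : B) = b) {n : ℕ} (W : Fin (n + 1) → Submodule A V)
    (hW : StrictMono W) (hW0 : ∀ a ∈ oneAnnihilator A B, ∀ x : V, a • x ∈ W 0) :
    (n : ℕ∞) ≤ Module.length Bᵐᵒᵖ (V →ₗ[A] B) := by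
  -- Annihilators in Hom_A(V, B) reverse the chain, strictly because B separates the points of V / W
  -- i, which J kills.
  let K : Fin (n + 1) → Submodule Bᵐᵒᵖ (V →ₗ[A] B) := fun i =>
    { carrier := {g | ∀ x ∈ W i, g x = 0}
      zero_mem' := fun _ _ => rfl
      add_mem' := fun {f g} hf hg x hx => by simp [hf x hx, hg x hx]
      smul_mem' := fun b f hf x hx => by simp [hf x hx] }
  have hK : ∀ i j, i < j → K j < K i := by
    intro i j hij
    obtain ⟨hle, x, hx, hxi⟩ := SetLike.lt_iff_le_and_exists.1 (hW hij)
    refine SetLike.lt_iff_le_and_exists.2 ⟨fun g hg x hx => hg x (hle hx), ?_⟩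
    obtain ⟨f, hf⟩ := exists_hom_apply_ne_zero (B := B) (V := V ⧸ W i) hB (fun a ha y => by
      obtain ⟨y, rfl⟩ := (W i).mkQ_surjective y
      rw [← map_smul]
      exact (Submodule.Quotient.mk_eq_zero _).2 (hW.monotone (Fin.zero_le i) (hW0 a ha y)))
      (v := (W i).mkQ x) (fun h => hxi ((Submodule.Quotient.mk_eq_zero _).1 h))
    refine ⟨f ∘ₗ (W i).mkQ, fun y hy => ?_, fun h => hf (h x hx)⟩
    have : (W i).mkQ y = 0 := (Submodule.Quotient.mk_eq_zero _).2 hy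
    rw [LinearMap.comp_apply, this, map_zero]
  let s : LTSeries (Submodule Bᵐᵒᵖ (V →ₗ[A] B)) :=
    LTSeries.mk n (fun i => K i.rev) fun i j hij => hK _ _ (Fin.rev_lt_rev.2 hij)
  have := Order.LTSeries.length_le_krullDim s
  rw [← Module.coe_length] at this
  exact_mod_cast this

/-- The vectors killed by J form a submodule T because J is two-sided. If T = 0, then J · J^n V = 0
forces J^n V = 0, and the exponent drops to 0, where V vanishes. -/
theorem smul_eq_zero_of_pow_smul_eq_zero {J : Ideal A} [J.IsTwoSided] [IsSimpleModule A V] (n : ℕ)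
    (h : ∀ x ∈ J ^ n, ∀ v : V, x • v = 0) : ∀ x ∈ J, ∀ v : V, x • v = 0 := by
  let T : Submodule A V :=
    { carrier := {v | ∀ x ∈ J, x • v = 0}
      zero_mem' := by simp
      add_mem' := fun {v w} hv hw x hx => by rw [smul_add, hv x hx, hw x hx, add_zero]
      smul_mem' := fun a v hv x hx => by
        rw [← mul_smul]; exact hv _ (J.mul_mem_right a hx) }
  rcases eq_bot_or_eq_top T with hT | hT
  · induction n with
    | zero =>
      intro x _ v
      rw [← one_smul A v, h 1 (by rw [Submodule.pow_zero, Ideal.one_eq_top]; trivial), smul_zero]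
    | succ n ih =>
      refine ih fun x hx v => ?_
      rw [← Submodule.mem_bot A, ← hT]
      intro j hj
      rw [← mul_smul]
      exact h _ (by rw [Ideal.IsTwoSided.pow_succ]; exact Ideal.mul_mem_mul hj hx) v
  · intro x hx v
    have : v ∈ T := hT ▸ Submodule.mem_top
    exact this x hx

end Cogenerator

/-! ### A uniform bound by induction on codimension. -/

section Cofinite

variable {k : Type v} [Field k] {A : Type u} [Ring A] [Algebra k A]
variable {B : Type u} [Ring B] [Algebra k B] [Module A B] [IsScalarTower k A B]
  [SMulCommClass A Bᵐᵒᵖ B]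

/-- For left ideals `L` of finite codimension that contain a power of the annihilator of `B`, the
length of `Hom_A(L, B)` is bounded by the length of `B`. -/
theorem DifferentialDuality.length_hom_le (D : DifferentialDuality k A) [IsSemisimpleModule A B]
    (hB : ∀ b : B, ∃ a : A, a • (1 : B) = b) (L : Ideal A) [Module.Finite k (A ⧸ L)]
    (n : ℕ) (hL : oneAnnihilator A B ^ n ≤ L) :
    Module.length Bᵐᵒᵖ (L →ₗ[A] B) ≤ Module.length Bᵐᵒᵖ B := by
  have := isTwoSided_oneAnnihilator (A := A) (B := B)
  induction hd : Module.finrank k (A ⧸ L) using Nat.strong_induction_on generalizing L with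
  | _ d ih =>
  by_cases htop : L = ⊤
  · subst htop
    let ev : ((⊤ : Ideal A) →ₗ[A] B) →ₗ[Bᵐᵒᵖ] B :=
      { toFun := fun g => g ⟨1, trivial⟩, map_add' := fun _ _ => rfl, map_smul' := fun _ _ => rfl }
    refine Module.length_le_of_injective ev fun f g hfg => ?_
    ext ⟨x, hx⟩
    have : (⟨x, hx⟩ : (⊤ : Ideal A)) = x • ⟨1, trivial⟩ := by ext; simp
    rw [this, map_smul, map_smul]
    exact congrArg (x • ·) hfg
  · have : Nontrivial (A ⧸ L) := Submodule.Quotient.nontrivial_iff.2 htop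
    have : IsArtinian A (A ⧸ L) := isArtinian_of_tower k inferInstance
    -- A simple T = L₁/L inside A/L makes L the kernel of a map onto a simple module from an ideal
    -- of smaller codimension.
    obtain ⟨T, hT, -⟩ := (eq_bot_or_exists_atom_le (⊤ : Submodule A (A ⧸ L))).resolve_left top_ne_bot
    have hTs : IsSimpleModule A T := isSimpleModule_iff_isAtom.2 hT
    let L₁ : Ideal A := T.comap L.mkQ
    let q : L₁ →ₗ[A] T := L.mkQ.restrict fun x hx => hx
    have hq : Function.Surjective q := by
      rintro ⟨y, hy⟩
      obtain ⟨x, rfl⟩ := L.mkQ_surjective y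
      exact ⟨⟨x, hy⟩, rfl⟩
    have hLL₁ : L ≤ L₁ := fun x hx => by
      have : L.mkQ x = 0 := (Submodule.Quotient.mk_eq_zero _).2 hx
      change L.mkQ x ∈ T
      rw [this]; exact T.zero_mem
    have hTJ : ∀ a ∈ oneAnnihilator A B, ∀ t : T, a • t = 0 := by
      refine smul_eq_zero_of_pow_smul_eq_zero (V := T) (J := oneAnnihilator A B) n ?_
      rintro x hx ⟨t, ht⟩
      obtain ⟨t, rfl⟩ := L.mkQ_surjective t
      ext
      change x • L.mkQ t = 0
      rw [← map_smul]
      exact (Submodule.Quotient.mk_eq_zero _).2 (hL (Ideal.mul_mem_right _ _ hx))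
    have hTfin : Module.Finite k T :=
      Module.Finite.of_injective (T.subtype.restrictScalars k) Subtype.val_injective
    have hTne : ∃ f : T →ₗ[A] B, f ≠ 0 := by
      have := IsSimpleModule.nontrivial A T
      obtain ⟨t, ht⟩ := exists_ne (0 : T)
      obtain ⟨f, hf⟩ := exists_hom_apply_ne_zero hB hTJ ht
      exact ⟨f, fun h => hf (by rw [h, LinearMap.zero_apply])⟩
    have h1 := D.length_hom_ker_le hB q hq hTne
    let e : LinearMap.ker q ≃ₗ[A] L :=
      { toFun := fun x => ⟨x.1, by
          have := congrArg Subtype.val (LinearMap.mem_ker.1 x.2)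
          exact (Submodule.Quotient.mk_eq_zero _).1 this⟩
        invFun := fun x => ⟨⟨x, hLL₁ x.2⟩, by
          rw [LinearMap.mem_ker]
          ext
          exact (Submodule.Quotient.mk_eq_zero _).2 x.2⟩
        left_inv := fun _ => rfl
        right_inv := fun _ => rfl
        map_add' := fun _ _ => rfl
        map_smul' := fun _ _ => rfl }
    let pre : (L →ₗ[A] B) →ₗ[Bᵐᵒᵖ] (LinearMap.ker q →ₗ[A] B) :=
      { toFun := fun g => g ∘ₗ e.toLinearMap
        map_add' := fun _ _ => rfl
        map_smul' := fun _ _ => rfl }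
    have h2 : Module.length Bᵐᵒᵖ (L →ₗ[A] B) ≤ Module.length Bᵐᵒᵖ (LinearMap.ker q →ₗ[A] B) :=
      Module.length_le_of_injective pre fun f g hfg => by
        ext x
        obtain ⟨y, rfl⟩ := e.surjective x
        exact LinearMap.congr_fun hfg y
    let pr : (A ⧸ L) →ₗ[k] (A ⧸ L₁) := (Submodule.factor hLL₁).restrictScalars k
    have hpr : Function.Surjective pr := Submodule.factor_surjective hLL₁
    have hfin : Module.Finite k (A ⧸ L₁) := Module.Finite.of_surjective pr hpr
    have hlt : Module.finrank k (A ⧸ L₁) < d := by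
      rw [← hd]
      refine lt_of_le_of_ne (LinearMap.finrank_le_finrank_of_surjective hpr) fun heq => ?_
      have hinj := (LinearMap.injective_iff_surjective_of_finrank_eq_finrank heq.symm).2 hpr
      refine hT.1 (eq_bot_iff.2 fun t ht => ?_)
      obtain ⟨t, rfl⟩ := L.mkQ_surjective t
      have h0 : pr (L.mkQ t) = 0 := (Submodule.Quotient.mk_eq_zero _).2 ht
      exact hinj (h0.trans (map_zero pr).symm)
    exact h2.trans (h1.trans (ih _ hlt L₁ (hL.trans hLL₁) rfl))

end Cofinite

/-! ### Graded Nakayama and reduction to homogeneous ideals. -/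

section GradedNoetherian

open DirectSum

variable {k : Type v} [Field k] {A : Type u} [Ring A] [Algebra k A]
variable (𝒜 : ℕ → Submodule k A) [GradedAlgebra 𝒜]

theorem coe_decompose_mul_eq_sum (x y : A) (n : ℕ) : (decompose 𝒜 (x * y) n : A) =
    ∑ ij ∈ Finset.HasAntidiagonal.antidiagonal n, (decompose 𝒜 x ij.1 : A) * decompose 𝒜 y ij.2 := by
  rw [decompose_mul, DirectSum.coe_mul_apply_eq_sum_antidiagonal]

/-- The ideal `A_{≥ n}`. -/
def gradedTail (n : ℕ) : Ideal A where
  carrier := {x | ∀ i < n, (decompose 𝒜 x i : A) = 0}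
  zero_mem' := by simp
  add_mem' := fun {x y} hx hy i hi => by simp [hx i hi, hy i hi]
  smul_mem' := fun a x hx i hi => by
    rw [smul_eq_mul, coe_decompose_mul_eq_sum]
    refine Finset.sum_eq_zero fun ij hij => ?_
    rw [hx _ (by have := Finset.HasAntidiagonal.mem_antidiagonal.1 hij; omega), mul_zero]

variable {𝒜}

theorem mem_gradedTail {n : ℕ} {x : A} :
    x ∈ gradedTail 𝒜 n ↔ ∀ i < n, (decompose 𝒜 x i : A) = 0 := Iff.rfl

theorem mul_mem_gradedTail {m n : ℕ} {x y : A} (hx : x ∈ gradedTail 𝒜 m)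
    (hy : y ∈ gradedTail 𝒜 n) : x * y ∈ gradedTail 𝒜 (m + n) := by
  intro i hi
  rw [coe_decompose_mul_eq_sum]
  refine Finset.sum_eq_zero fun ij hij => ?_
  have := Finset.HasAntidiagonal.mem_antidiagonal.1 hij
  rcases lt_or_ge ij.1 m with h | h
  · rw [hx _ h, zero_mul]
  · rw [hy _ (by omega), mul_zero]

theorem mem_gradedTail_zero (x : A) : x ∈ gradedTail 𝒜 0 := fun _ hi => absurd hi (by omega)

theorem pow_le_gradedTail {J : Ideal A} [J.IsTwoSided] {m : ℕ} (hJ : J ^ m ≤ gradedTail 𝒜 1)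
    (n : ℕ) : ∃ N, J ^ N ≤ gradedTail 𝒜 n := by
  induction n with
  | zero => exact ⟨0, fun x _ => mem_gradedTail_zero x⟩
  | succ n ih =>
    obtain ⟨N, hN⟩ := ih
    refine ⟨m + N, ?_⟩
    rw [Ideal.IsTwoSided.pow_add, Ideal.mul_le]
    intro r hr s hs
    rw [add_comm]
    exact mul_mem_gradedTail (hJ hr) (hN hs)

theorem finite_quotient_gradedTail (locallyFinite : ∀ n, Module.Finite k (𝒜 n)) (n : ℕ) :
    Module.Finite k (A ⧸ gradedTail 𝒜 n) := by
  let f : A →ₗ[k] ∀ i : Fin n, 𝒜 i := LinearMap.pi fun i =>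
    (DirectSum.component k ℕ (fun i => 𝒜 i) i) ∘ₗ (decomposeLinearEquiv 𝒜).toLinearMap
  have hf : LinearMap.ker f = (gradedTail 𝒜 n).restrictScalars k := by
    ext x
    rw [LinearMap.mem_ker, Submodule.restrictScalars_mem, mem_gradedTail]
    refine ⟨fun h i hi => congrArg Subtype.val (congrFun h ⟨i, hi⟩), fun h => ?_⟩
    ext i
    exact h i i.2
  have h1 : Module.Finite k (A ⧸ (gradedTail 𝒜 n).restrictScalars k) := by
    rw [← hf]
    exact Module.Finite.equiv f.quotKerEquivRange.symm
  exact Module.Finite.equiv (Submodule.Quotient.restrictScalarsEquiv k (gradedTail 𝒜 n))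

theorem isHomogeneous_mul {I J : Ideal A} (hJ : J.IsHomogeneous 𝒜) (hI : I.IsHomogeneous 𝒜) :
    (J * I).IsHomogeneous 𝒜 := by
  intro n x hx
  induction hx using Submodule.smul_induction_on' with
  | smul r hr s hs =>
    rw [smul_eq_mul, coe_decompose_mul_eq_sum]
    exact sum_mem fun ij _ => Ideal.mul_mem_mul (hJ _ hr) (hI _ hs)
  | add x _ y _ hx hy =>
    rw [decompose_add, DirectSum.add_apply, Submodule.coe_add]
    exact add_mem hx hy

/-- Graded Nakayama lemma. -/
theorem le_of_le_sup_mul {J I P : Ideal A} [J.IsTwoSided]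
    (hJ : ∀ n, ∃ N, J ^ N ≤ gradedTail 𝒜 n) (hI : I.IsHomogeneous 𝒜) (hP : P.IsHomogeneous 𝒜)
    (h : I ≤ P ⊔ J * I) : I ≤ P := by
  -- In degree d the term J^N I disappears once J^N lies in A_{≥ d+1}.
  have key : ∀ N, I ≤ P ⊔ J ^ N * I := by
    intro N
    induction N with
    | zero => rw [Submodule.pow_zero, Ideal.one_eq_top, Ideal.top_mul]; exact le_sup_right
    | succ N ih =>
      refine ih.trans (sup_le le_sup_left (Ideal.mul_le.2 fun r hr s hs => ?_))
      obtain ⟨p, hp, t, ht, rfl⟩ := Submodule.mem_sup.1 (h hs)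
      rw [mul_add]
      refine add_mem (Submodule.mem_sup_left (P.mul_mem_left _ hp)) (Submodule.mem_sup_right ?_)
      clear hs
      induction ht using Submodule.smul_induction_on' with
      | smul j hj z hz =>
        rw [smul_eq_mul, ← mul_assoc, Submodule.pow_succ]
        exact Ideal.mul_mem_mul (Ideal.mul_mem_mul hr hj) hz
      | add x _ y _ hx hy =>
        rw [mul_add]
        exact add_mem hx hy
  intro x hx
  refine (hP.mem_iff 𝒜).2 fun d => ?_
  obtain ⟨N, hN⟩ := hJ (d + 1)
  obtain ⟨p, hp, t, ht, hpt⟩ := Submodule.mem_sup.1 (key N (hI d hx))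
  have htail : t ∈ gradedTail 𝒜 (d + 1) := by
    exact (Ideal.mul_le.2 fun r hr s _ => by
      simpa using mul_mem_gradedTail (hN hr) (mem_gradedTail_zero s) : J ^ N * I ≤ gradedTail 𝒜 (d + 1)) ht
  have h1 := congrArg (fun y => (decompose 𝒜 y d : A)) hpt
  simp only [decompose_add, DirectSum.add_apply, Submodule.coe_add, htail d (Nat.lt_succ_self d),
    add_zero, decompose_coe, DirectSum.of_eq_same] at h1
  rw [← h1]
  exact hP d hp

theorem mem_of_mem_sup_gradedTail {P : Ideal A} (hP : P.IsHomogeneous 𝒜) {n d : ℕ} (hd : d < n)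
    {x : A} (hx : x ∈ 𝒜 d) (h : x ∈ P ⊔ gradedTail 𝒜 n) : x ∈ P := by
  obtain ⟨p, hp, t, ht, hpt⟩ := Submodule.mem_sup.1 h
  have h1 := congrArg (fun y => (decompose 𝒜 y d : A)) hpt
  simp only [decompose_add, DirectSum.add_apply, Submodule.coe_add, ht d hd,
    add_zero, decompose_of_mem_same 𝒜 hx] at h1
  rw [← h1]
  exact hP d hp

/-- A criterion for homogeneous left ideals to be finitely generated: chains of submodules of
cofinite left ideals above the radical have bounded length. -/
theorem fg_of_isHomogeneous (locallyFinite : ∀ n, Module.Finite k (𝒜 n))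
    {J : Ideal A} [J.IsTwoSided] (hJ : J.IsHomogeneous 𝒜)
    (hJn : ∀ n, ∃ N, J ^ N ≤ gradedTail 𝒜 n) (b : ℕ)
    (bound : ∀ (L : Ideal A) [Module.Finite k (A ⧸ L)] (N : ℕ), J ^ N ≤ L →
      ∀ (r : ℕ) (W : Fin (r + 1) → Submodule A L), StrictMono W →
        (∀ a ∈ J, ∀ x : L, a • x ∈ W 0) → r ≤ b)
    {I : Ideal A} (hI : I.IsHomogeneous 𝒜) : I.FG := by
  classical
  by_contra hfg
  let Good := {s : Finset A // ∀ x ∈ s, x ∈ I ∧ SetLike.IsHomogeneousElem 𝒜 x}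
  have hom : ∀ s : Good, (Ideal.span (s.1 : Set A)).IsHomogeneous 𝒜 := fun s =>
    Ideal.homogeneous_span 𝒜 _ fun x hx => (s.2 x hx).2
  have homP : ∀ s : Good, (Ideal.span (s.1 : Set A) ⊔ J * I).IsHomogeneous 𝒜 := fun s =>
    (hom s).sup (isHomogeneous_mul hJ hI)
  -- Otherwise I ≤ span s + JI by homogeneity, and Nakayama would make s generate I.
  have step : ∀ s : Good, ∃ y : A, (y ∈ I ∧ SetLike.IsHomogeneousElem 𝒜 y) ∧
      y ∉ Ideal.span (s.1 : Set A) ⊔ J * I := by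
    intro s
    by_contra hcon
    push Not at hcon
    have hle : I ≤ Ideal.span (s.1 : Set A) := by
      refine le_of_le_sup_mul hJn hI (hom s) fun x hx => ?_
      refine ((homP s).mem_iff 𝒜).2 fun d => hcon _ ⟨hI d hx, ⟨d, SetLike.coe_mem _⟩⟩
    have heq : I = Ideal.span (s.1 : Set A) :=
      le_antisymm hle (Ideal.span_le.2 fun x hx => (s.2 x hx).1)
    exact hfg ⟨s.1, heq.symm⟩
  choose g hg hgn using step
  let next : Good → Good := fun s => ⟨insert (g s) s.1, fun x hx => by
    rcases Finset.mem_insert.1 hx with rfl | hx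
    · exact hg s
    · exact s.2 x hx⟩
  let s : ℕ → Good := fun n => next^[n] ⟨∅, by simp⟩
  have hs : ∀ n, s (n + 1) = next (s n) := fun n => Function.iterate_succ_apply' _ _ _
  let P : ℕ → Ideal A := fun n => Ideal.span ((s n).1 : Set A) ⊔ J * I
  have hmono : ∀ n, P n ≤ P (n + 1) := fun n => by
    refine sup_le_sup_right (Ideal.span_mono ?_) _
    rw [hs]
    exact Finset.coe_subset.2 (Finset.subset_insert _ _)
  have hmem : ∀ n, g (s n) ∈ P (n + 1) := fun n => by
    refine Submodule.mem_sup_left (Ideal.subset_span ?_)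
    rw [hs]
    exact Finset.mem_coe.2 (Finset.mem_insert_self _ _)
  choose d hd using fun n => (hg (s n)).2
  -- Beyond the degrees of the first b + 1 chosen elements, so adding A_{≥ n₀} keeps the inclusions
  -- strict; L becomes cofinite.
  let n₀ := (Finset.range (b + 1)).sup d + 1
  let L : Ideal A := I ⊔ gradedTail 𝒜 n₀
  have hfin : Module.Finite k (A ⧸ L) := by
    have := finite_quotient_gradedTail locallyFinite n₀
    have hle : gradedTail 𝒜 n₀ ≤ L := le_sup_right
    exact Module.Finite.of_surjective ((Submodule.factor hle).restrictScalars k)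
      (Submodule.factor_surjective hle)
  obtain ⟨N, hN⟩ := hJn n₀
  -- These b + 2 terms have b + 1 strict steps, one more than `bound` allows.
  let W : Fin (b + 1 + 1) → Submodule A L := fun i =>
    Submodule.comap (Submodule.subtype L) (P i ⊔ gradedTail 𝒜 n₀)
  have hW : StrictMono W := by
    refine Fin.strictMono_iff_lt_succ.2 fun i => SetLike.lt_iff_le_and_exists.2 ⟨?_, ?_⟩
    · exact Submodule.comap_mono (sup_le_sup_right (hmono i) _)
    · refine ⟨⟨g (s i), Submodule.mem_sup_left (hg _).1⟩, Submodule.mem_sup_left (hmem i),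
        fun h => hgn (s i) ?_⟩
      refine mem_of_mem_sup_gradedTail (homP (s i)) (n := n₀) ?_ (hd i) h
      exact Nat.lt_succ_of_le (Finset.le_sup (f := d) (Finset.mem_range.2 i.2))
  have := bound L N (hN.trans le_sup_right) (b + 1) W hW (by
    rintro a ha ⟨x, hx⟩
    obtain ⟨y, hy, t, ht, rfl⟩ := Submodule.mem_sup.1 hx
    change a * (y + t) ∈ P 0 ⊔ gradedTail 𝒜 n₀
    rw [mul_add]
    exact add_mem (Submodule.mem_sup_left (Submodule.mem_sup_right (Ideal.mul_mem_mul ha hy)))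
      (Submodule.mem_sup_right (Ideal.mul_mem_left _ _ ht)))
  omega

/-- A graded ring whose homogeneous left ideals are finitely generated is left noetherian. -/
theorem isNoetherianRing_of_isHomogeneous_fg
    (h : ∀ I : Ideal A, I.IsHomogeneous 𝒜 → I.FG) : IsNoetherianRing A := by
  classical
  refine (isNoetherianRing_iff_ideal_fg A).2 fun I => ?_
  -- Here d only bounds the degree of x, so the component taken may be zero.
  let lead : Set A := {a | ∃ d, ∃ x ∈ I, (∀ e, d < e → (decompose 𝒜 x e : A) = 0) ∧
    a = decompose 𝒜 x d}
  have hlead : (Ideal.span lead).IsHomogeneous 𝒜 := Ideal.homogeneous_span 𝒜 _ (by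
    rintro _ ⟨d, x, -, -, rfl⟩
    exact ⟨d, SetLike.coe_mem _⟩)
  obtain ⟨F, hF, hspan⟩ := Submodule.fg_span_iff_fg_span_finset_subset lead |>.1 (h _ hlead)
  have hF' : ∀ a ∈ F, ∃ d, ∃ x ∈ I, (∀ e, d < e → (decompose 𝒜 x e : A) = 0) ∧
    a = decompose 𝒜 x d := fun a ha => hF ha
  choose! d x hx hxd hxa using hF'
  let N : Ideal A := Ideal.span (F.image x : Set A)
  -- Each component of an element of the leading ideal is realised as the top component of an
  -- element of N, which lets `descend` lower degrees by subtraction.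
  have key : ∀ y ∈ Ideal.span (F : Set A), ∀ n, ∃ z ∈ N,
      (decompose 𝒜 z n : A) = decompose 𝒜 y n ∧ ∀ e, n < e → (decompose 𝒜 z e : A) = 0 := by
    intro y hy
    induction hy using Submodule.span_induction with
    | mem a ha =>
      intro n
      have ha' : a ∈ 𝒜 (d a) := by
        have h0 := (decompose 𝒜 (x a) (d a)).2
        rwa [← hxa a ha] at h0
      by_cases hn : d a = n
      · subst hn
        refine ⟨x a, Ideal.subset_span (Finset.mem_coe.2 (Finset.mem_image_of_mem x ha)), ?_,
          hxd a ha⟩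
        rw [decompose_of_mem_same 𝒜 ha', ← hxa a ha]
      · exact ⟨0, N.zero_mem, by simp [decompose_of_mem_ne 𝒜 ha' hn], by simp⟩
    | zero => exact fun n => ⟨0, N.zero_mem, rfl, by simp⟩
    | add y y' _ _ hy hy' =>
      intro n
      obtain ⟨z, hz, h1, h2⟩ := hy n
      obtain ⟨z', hz', h1', h2'⟩ := hy' n
      exact ⟨z + z', N.add_mem hz hz', by simp [h1, h1'], fun e he => by simp [h2 e he, h2' e he]⟩
    | smul c y _ hy =>
      intro n
      choose z hz h1 h2 using hy
      refine ⟨∑ ij ∈ Finset.HasAntidiagonal.antidiagonal n, (decompose 𝒜 c ij.1 : A) * z ij.2,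
        sum_mem fun ij _ => N.mul_mem_left _ (hz _), ?_, fun e he => ?_⟩
      · rw [smul_eq_mul, coe_decompose_mul_eq_sum, decompose_sum, DFinsupp.finsetSum_apply,
          AddSubmonoidClass.coe_finsetSum]
        refine Finset.sum_congr rfl fun ij hij => ?_
        rw [← Finset.HasAntidiagonal.mem_antidiagonal.1 hij,
          coe_decompose_mul_add_of_left_mem 𝒜 (SetLike.coe_mem _), h1]
      · rw [decompose_sum, DFinsupp.finsetSum_apply, AddSubmonoidClass.coe_finsetSum]
        refine Finset.sum_eq_zero fun ij hij => ?_
        have hij' := Finset.HasAntidiagonal.mem_antidiagonal.1 hij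
        obtain ⟨f, rfl⟩ := Nat.exists_eq_add_of_le (show ij.1 ≤ e by omega)
        rw [coe_decompose_mul_add_of_left_mem 𝒜 (SetLike.coe_mem _), h2 _ _ (by omega), mul_zero]
  have hNI : N ≤ I := Ideal.span_le.2 (by
    intro y hy
    obtain ⟨a, ha, rfl⟩ := Finset.mem_image.1 (Finset.mem_coe.1 hy)
    exact hx a ha)
  have descend : ∀ n, ∀ y ∈ I, (∀ e, n ≤ e → (decompose 𝒜 y e : A) = 0) → y ∈ N := by
    intro n
    induction n with
    | zero =>
      intro y _ hy
      have : y = 0 := by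
        rw [← sum_support_decompose 𝒜 y]
        exact Finset.sum_eq_zero fun i _ => hy i (Nat.zero_le i)
      rw [this]
      exact N.zero_mem
    | succ n ih =>
      intro y hyI hy
      obtain ⟨z, hz, h1, h2⟩ := key (decompose 𝒜 y n : A)
        (by
          have h3 : (decompose 𝒜 y n : A) ∈ Ideal.span lead :=
            Ideal.subset_span ⟨n, y, hyI, fun e he => hy e he, rfl⟩
          rwa [Ideal.span, hspan] at h3) n
      rw [decompose_of_mem_same 𝒜 (SetLike.coe_mem _)] at h1
      have : y - z ∈ N := ih _ (I.sub_mem hyI (hNI hz)) fun e he => by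
        rcases he.eq_or_lt with rfl | he
        · simp [h1]
        · simp [h2 e he, hy e he]
      simpa using N.add_mem this hz
  refine ⟨F.image x, le_antisymm hNI fun y hy => ?_⟩
  refine descend ((decompose 𝒜 y).support.sup id + 1) y hy fun e he => ?_
  by_contra hne
  have : e ≤ (decompose 𝒜 y).support.sup id :=
    Finset.le_sup (f := id) (DFinsupp.mem_support_iff.2 fun h0 => hne (by rw [h0]; rfl))
  omega

end GradedNoetherian

/-! ### The left noetherian property from the duality data. -/

section Noetherian

variable {k : Type v} [Field k] {A : Type u} [Ring A] [Algebra k A]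

theorem DifferentialDuality.isNoetherianRing_of_algHom (D : DifferentialDuality k A)
    {𝒜 : ℕ → Submodule k A} [GradedAlgebra 𝒜] (locallyFinite : ∀ n, Module.Finite k (𝒜 n))
    {B : Type u} [Ring B] [Algebra k B] [Module.Finite k B] [IsSemisimpleRing B]
    (π : A →ₐ[k] B) (hπ : Function.Surjective π)
    (hom : (RingHom.ker π).IsHomogeneous 𝒜) {m : ℕ} (hm : RingHom.ker π ^ m ≤ gradedTail 𝒜 1) :
    IsNoetherianRing A := by
  let _ : Module A B := Module.compHom B π.toRingHom
  have hsmul : ∀ (a : A) (b : B), a • b = π a * b := fun _ _ => rfl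
  have : IsScalarTower k A B := ⟨fun c a b => by rw [hsmul, hsmul, map_smul, smul_mul_assoc]⟩
  have : SMulCommClass A Bᵐᵒᵖ B := ⟨fun a b c => by
    change π a * (c * b.unop) = π a * c * b.unop
    rw [mul_assoc]⟩
  have hB : ∀ b : B, ∃ a : A, a • (1 : B) = b := fun b => by
    obtain ⟨a, rfl⟩ := hπ b
    exact ⟨a, by rw [hsmul, mul_one]⟩
  have hker : oneAnnihilator A B = RingHom.ker π := by
    ext a
    rw [mem_oneAnnihilator, hsmul, mul_one, RingHom.mem_ker]
  have : IsSemisimpleModule A B := by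
    have : RingHomSurjective π.toRingHom := ⟨hπ⟩
    let l : B →ₛₗ[π.toRingHom] B :=
      { toFun := id, map_add' := fun _ _ => rfl, map_smul' := fun _ _ => rfl }
    exact (l.isSemisimpleModule_iff_of_bijective Function.bijective_id).2 inferInstance
  have : IsArtinian Bᵐᵒᵖ B := isArtinian_of_tower k inferInstance
  have : IsNoetherian Bᵐᵒᵖ B := isNoetherian_of_tower k inferInstance
  obtain ⟨b, hb⟩ := ENat.ne_top_iff_exists.1 (Module.length_ne_top (R := Bᵐᵒᵖ) (M := B))
  refine isNoetherianRing_of_isHomogeneous_fg (𝒜 := 𝒜) fun I hI => ?_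
  refine fg_of_isHomogeneous locallyFinite hom (fun n => pow_le_gradedTail hm n) b ?_ hI
  intro L _ N hN r W hW hW0
  rw [← hker] at hN hW0
  have h1 := le_length_hom_of_strictMono hB W hW hW0
  have h2 := D.length_hom_le hB L N hN
  rw [← hb] at h2
  exact_mod_cast h1.trans h2

/-- The quotient used is A → A_0 → A_0/rad A_0. The radical of the finite-dimensional A_0 is
nilpotent, so a power of the kernel lies in A_{≥1}. -/
theorem DifferentialDuality.isNoetherianRing (D : DifferentialDuality k A)
    (𝒜 : ℕ → Submodule k A) [GradedAlgebra 𝒜] (locallyFinite : ∀ n, Module.Finite k (𝒜 n)) :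
    IsNoetherianRing A := by
  have : Module.Finite k (𝒜 0) := locallyFinite 0
  have : IsScalarTower k (𝒜 0) (𝒜 0) := ⟨fun c x y => Subtype.ext (smul_mul_assoc c x.1 y.1)⟩
  have : IsArtinianRing (𝒜 0) := isArtinian_of_tower k inferInstance
  have hss : IsSemiprimaryRing (𝒜 0) := inferInstance
  obtain ⟨m, hm⟩ := hss.isNilpotent
  let π₀ : A →+* 𝒜 0 := GradedRing.projZeroRingHom' 𝒜
  let π₁ : 𝒜 0 →+* (𝒜 0 ⧸ Ring.jacobson (𝒜 0)) := Ideal.Quotient.mk _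
  let π : A →ₐ[k] (𝒜 0 ⧸ Ring.jacobson (𝒜 0)) :=
    { π₁.comp π₀ with
      commutes' := fun c => by
        exact congrArg π₁ (GradedRing.projZeroRingHom'_apply_coe 𝒜 (algebraMap k (𝒜 0) c)) }
  have hker : ∀ x, x ∈ RingHom.ker π ↔ π₀ x ∈ Ring.jacobson (𝒜 0) := fun x =>
    Ideal.Quotient.eq_zero_iff_mem
  have : Module.Finite k (𝒜 0 ⧸ Ring.jacobson (𝒜 0)) :=
    Module.Finite.of_surjective (Ideal.Quotient.mkₐ k (Ring.jacobson (𝒜 0))).toLinearMap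
      Ideal.Quotient.mk_surjective
  refine D.isNoetherianRing_of_algHom locallyFinite π (Ideal.Quotient.mk_surjective.comp
    (GradedRing.projZeroRingHom'_surjective 𝒜)) ?_ (m := m) ?_
  · intro i x hx
    rw [hker] at hx ⊢
    rcases eq_or_ne i 0 with rfl | hi
    · have : π₀ (DirectSum.decompose 𝒜 x 0 : A) = π₀ x :=
        (GradedRing.projZeroRingHom'_apply_coe 𝒜 _).trans rfl
      rwa [this]
    · have : π₀ (DirectSum.decompose 𝒜 x i : A) = 0 :=
        Subtype.ext (DirectSum.decompose_of_mem_ne 𝒜 (SetLike.coe_mem _) hi)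
      rw [this]
      exact zero_mem _
  · have key : ∀ n, ∀ x ∈ RingHom.ker π ^ n, π₀ x ∈ Ring.jacobson (𝒜 0) ^ n := by
      intro n
      induction n with
      | zero => intro x _; rw [Submodule.pow_zero, Ideal.one_eq_top]; trivial
      | succ n ih =>
        intro x hx
        rw [Submodule.pow_succ] at hx ⊢
        refine Submodule.mul_induction_on hx (fun a ha b hb => ?_) fun a b ha hb => ?_
        · rw [map_mul]
          exact Ideal.mul_mem_mul (ih a ha) ((hker b).1 hb)
        · rw [map_add]
          exact add_mem ha hb
    intro x hx i hi
    obtain rfl : i = 0 := by omega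
    have := key m x hx
    rw [hm] at this
    exact congrArg Subtype.val this

end Noetherian

/-! ### Transport of the duality to the opposite algebra. -/

section Opposite

variable {k : Type v} [Field k] {A : Type u} [Ring A] [Algebra k A]

/-- A bimodule over `A` as a bimodule over `Aᵐᵒᵖ`, with the two sides exchanged. -/
abbrev CentralBimodule.opposite (U : CentralBimodule k A) : CentralBimodule k Aᵐᵒᵖ :=
  letI m : Module Aᵐᵒᵖᵐᵒᵖ U.carrier := Module.compHom U.carrier (RingEquiv.opOp A).symm.toRingHom
  { carrier := U.carrier
    moduleRight := m
    smulComm := ⟨fun a b x => (smul_comm b.unop.unop a x).symm⟩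
    towerLeft := U.towerRight
    towerRight := ⟨fun c a x => smul_assoc c a.unop.unop x⟩ }

/-- Swapping the tensor factors turns each balancing relation into the negative of one for the other
order. -/
theorem TensorIsoRegular.opposite {U V : CentralBimodule k A} (h : TensorIsoRegular V U) :
    TensorIsoRegular U.opposite V.opposite := by
  obtain ⟨φ, hφ⟩ := h
  let c : U.opposite.carrier ⊗[k] V.opposite.carrier ≃ₗ[k] V.carrier ⊗[k] U.carrier :=
    TensorProduct.comm k U.carrier V.carrier
  have hrel : ∀ (u : U.carrier) (a : A) (w : V.carrier),
      c ((op (op a) • (show U.opposite.carrier from u)) ⊗ₜ[k] (show V.opposite.carrier from w) -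
        (show U.opposite.carrier from u) ⊗ₜ[k] (op a • (show V.opposite.carrier from w))) =
      -((op a • w) ⊗ₜ[k] u - w ⊗ₜ[k] (a • u)) := by
    intro u a w
    rw [neg_sub, map_sub]
    rfl
  have hc : (balancedRelations U.opposite V.opposite).map c.toLinearMap = balancedRelations V U := by
    refine (Submodule.map_span _ _).trans (le_antisymm (Submodule.span_le.2 ?_)
      (Submodule.span_le.2 ?_))
    · rintro _ ⟨_, ⟨u, a, w, rfl⟩, rfl⟩
      have h1 := hrel u a.unop w
      have h2 : -((op a.unop • (w : V.carrier)) ⊗ₜ[k] (u : U.carrier) - w ⊗ₜ[k] (a.unop • u)) ∈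
          balancedRelations V U :=
        neg_mem (Submodule.subset_span ⟨w, a.unop, u, rfl⟩)
      exact (congrArg (· ∈ balancedRelations V U) h1).mpr h2
    · rintro _ ⟨w, a, u, rfl⟩
      have h1 := hrel u a w
      rw [eq_neg_iff_add_eq_zero, add_comm, ← eq_neg_iff_add_eq_zero] at h1
      rw [h1]
      exact neg_mem (Submodule.subset_span ⟨_, ⟨u, op a, w, rfl⟩, rfl⟩)
  let e : BalancedTensor U.opposite V.opposite ≃ₗ[k] BalancedTensor V U :=
    Submodule.Quotient.equiv (balancedRelations U.opposite V.opposite) (balancedRelations V U) c hc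
  refine ⟨e.trans (φ.trans (opLinearEquiv k)), fun a b u w => ?_⟩
  exact congrArg op ((hφ b.unop a.unop w u).trans (mul_assoc _ _ _))

variable (k A) in
/-- The isomorphism of the enveloping algebras of `A` and `Aᵐᵒᵖ`. -/
noncomputable def envelopingFlip : A ⊗[k] Aᵐᵒᵖ ≃ₐ[k] Aᵐᵒᵖ ⊗[k] Aᵐᵒᵖᵐᵒᵖ :=
  (Algebra.TensorProduct.comm k A Aᵐᵒᵖ).trans
    (Algebra.TensorProduct.congr AlgEquiv.refl (AlgEquiv.opOp k A))

@[simp]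
theorem envelopingFlip_tmul (a : A) (b : Aᵐᵒᵖ) :
    envelopingFlip k A (a ⊗ₜ b) = b ⊗ₜ op (op a) := by
  simp [envelopingFlip]

theorem univDer_op (a : A) : univDer k Aᵐᵒᵖ (op a) = -envelopingFlip k A (univDer k A a) := by
  simp

theorem mulOpMap_envelopingFlip (w : A ⊗[k] Aᵐᵒᵖ) :
    mulOpMap k Aᵐᵒᵖ (envelopingFlip k A w) = op (mulOpMap k A w) := by
  induction w using TensorProduct.induction_on with
  | zero => simp
  | tmul a b => simp
  | add x y hx hy => rw [map_add, map_add, hx, hy, map_add, MulOpposite.op_add]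

/-- The map on double derivations that passes to the opposite algebra. -/
noncomputable def oppositeDer : (A →ₗ[k] A ⊗[k] Aᵐᵒᵖ) →+ (Aᵐᵒᵖ →ₗ[k] Aᵐᵒᵖ ⊗[k] Aᵐᵒᵖᵐᵒᵖ) where
  toFun f := (envelopingFlip k A).toLinearEquiv.toLinearMap ∘ₗ f ∘ₗ
    (opLinearEquiv k).symm.toLinearMap
  map_zero' := LinearMap.ext fun _ => map_zero (envelopingFlip k A)
  map_add' _ _ := LinearMap.ext fun _ => map_add (envelopingFlip k A) _ _

theorem oppositeDer_apply_op (f : A →ₗ[k] A ⊗[k] Aᵐᵒᵖ) (a : A) :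
    oppositeDer f (op a) = envelopingFlip k A (f a) := rfl

/-- The opposite algebra inherits the duality. -/
noncomputable def DifferentialDuality.opposite (D : DifferentialDuality k A) :
    DifferentialDuality k Aᵐᵒᵖ where
  U := D.U.opposite
  V := D.V.opposite
  left := D.right.opposite
  right := D.left.opposite
  H := D.H
  toDer := oppositeDer.comp D.toDer
  toU := D.toU
  toU_surjective := D.toU_surjective
  exists_mul_right h a b := by
    obtain ⟨h', hh', hu⟩ := D.exists_mul_right h b.unop a.unop
    refine ⟨h', fun c => ?_, hu.trans (smul_comm a.unop b (D.toU h))⟩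
    rw [← op_unop c, AddMonoidHom.comp_apply, AddMonoidHom.comp_apply, oppositeDer_apply_op,
      oppositeDer_apply_op, hh', map_mul, envelopingFlip_tmul, op_unop, op_unop]
  inner h hh := by
    obtain ⟨r, hr⟩ := D.inner h hh
    refine ⟨-envelopingFlip k A r, fun c => ?_⟩
    rw [← op_unop c, AddMonoidHom.comp_apply, oppositeDer_apply_op, hr, map_mul, univDer_op]
    exact (neg_mul_neg (envelopingFlip k A (univDer k A c.unop)) (envelopingFlip k A r)).symm
  n := D.n
  -- The flip negates the universal derivation; the sign is absorbed here and in the witness for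
  -- `inner`.
  form := fun i => -envelopingFlip k A (D.form i)
  dual := D.dual
  mulOpMap_form i := by
    rw [map_neg, mulOpMap_envelopingFlip, D.mulOpMap_form, MulOpposite.op_zero, neg_zero]
  dual_basis a := by
    rw [← op_unop a, univDer_op, D.dual_basis, map_sum, ← Finset.sum_neg_distrib]
    refine Finset.sum_congr rfl fun i _ => ?_
    rw [AddMonoidHom.comp_apply, oppositeDer_apply_op, map_mul]
    exact (mul_neg (envelopingFlip k A (D.toDer (D.dual i) a.unop))
      (envelopingFlip k A (D.form i))).symm

end Opposite

/-! ### The grading on the opposite algebra. -/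

section OppositeGrading

variable {k : Type v} [Field k] {A : Type u} [Ring A] [Algebra k A]
variable (𝒜 : ℕ → Submodule k A)

/-- The grading of the opposite algebra. -/
def oppositeGrading (n : ℕ) : Submodule k Aᵐᵒᵖ :=
  (𝒜 n).map (opLinearEquiv k).toLinearMap

theorem mem_oppositeGrading {n : ℕ} {x : Aᵐᵒᵖ} : x ∈ oppositeGrading 𝒜 n ↔ x.unop ∈ 𝒜 n := by
  constructor
  · rintro ⟨a, ha, rfl⟩
    exact ha
  · intro h
    exact ⟨x.unop, h, rfl⟩

/-- The isomorphism of a homogeneous component of the opposite algebra. -/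
def oppositeGradingEquiv (n : ℕ) : 𝒜 n ≃ₗ[k] oppositeGrading 𝒜 n :=
  (opLinearEquiv k).submoduleMap (𝒜 n)

theorem finite_oppositeGrading (h : ∀ n, Module.Finite k (𝒜 n)) (n : ℕ) :
    Module.Finite k (oppositeGrading 𝒜 n) :=
  have := h n
  Module.Finite.equiv (oppositeGradingEquiv 𝒜 n)

/-- The isomorphism from the sum of the components to the sum of the opposite components. -/
noncomputable def oppositeGradingSum :
    (DirectSum ℕ fun n => 𝒜 n) →ₗ[k] DirectSum ℕ fun n => oppositeGrading 𝒜 n :=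
  DirectSum.toModule k ℕ _ fun n =>
    DirectSum.lof k ℕ (fun n => oppositeGrading 𝒜 n) n ∘ₗ (oppositeGradingEquiv 𝒜 n).toLinearMap

theorem coeLinearMap_oppositeGradingSum (y : DirectSum ℕ fun n => 𝒜 n) :
    DirectSum.coeLinearMap (oppositeGrading 𝒜) (oppositeGradingSum 𝒜 y) =
      op (DirectSum.coeLinearMap 𝒜 y) := by
  have : DirectSum.coeLinearMap (oppositeGrading 𝒜) ∘ₗ oppositeGradingSum 𝒜 =
      (opLinearEquiv k).toLinearMap ∘ₗ DirectSum.coeLinearMap 𝒜 := by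
    refine DirectSum.linearMap_ext k fun n => LinearMap.ext fun x => ?_
    simp only [LinearMap.comp_apply, oppositeGradingSum, DirectSum.toModule_lof]
    exact (DirectSum.coeLinearMap_lof _ _ _).trans
      (congrArg op (DirectSum.coeLinearMap_lof 𝒜 n x)).symm
  exact LinearMap.congr_fun this y

variable [GradedAlgebra 𝒜]

noncomputable instance : DirectSum.Decomposition (oppositeGrading 𝒜) :=
  DirectSum.Decomposition.ofLinearMap _
    (oppositeGradingSum 𝒜 ∘ₗ (DirectSum.decomposeLinearEquiv 𝒜).toLinearMap ∘ₗ
      (opLinearEquiv k).symm.toLinearMap)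
    (LinearMap.ext fun x => by
      rw [LinearMap.comp_apply, LinearMap.comp_apply, coeLinearMap_oppositeGradingSum]
      exact congrArg op ((DirectSum.decompose 𝒜).symm_apply_apply x.unop))
    (DirectSum.linearMap_ext k fun n => LinearMap.ext fun x => by
      obtain ⟨y, rfl⟩ := (oppositeGradingEquiv 𝒜 n).surjective x
      rw [LinearMap.comp_apply, LinearMap.comp_apply, DirectSum.coeLinearMap_lof]
      have h1 : DirectSum.decompose 𝒜 (y : A) = DirectSum.lof k ℕ (fun n => 𝒜 n) n y :=
        DirectSum.decompose_coe 𝒜 y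
      change oppositeGradingSum 𝒜 (DirectSum.decompose 𝒜 (y : A)) = _
      rw [h1, oppositeGradingSum, DirectSum.toModule_lof]
      rfl)

noncomputable instance : GradedAlgebra (oppositeGrading 𝒜) where
  one_mem := (mem_oppositeGrading 𝒜).2 (SetLike.GradedOne.one_mem (A := 𝒜))
  mul_mem i j x y hx hy := by
    rw [mem_oppositeGrading] at hx hy ⊢
    rw [unop_mul, add_comm]
    exact SetLike.GradedMul.mul_mem hy hx

end OppositeGrading

/-! ### Perfect modules with Ext into R vanishing from degree two on. -/

section ProjectiveDimension

variable {R : Type u} [Ring R]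

/-- X₁ is a summand of some R^n, so vanishing of Ext^1(X₃, R) lets the coordinate maps extend to X₂
and assemble to a retraction that splits the sequence. -/
theorem ModuleCat.projective_X₃_of_subsingleton_ext {S : ShortComplex (ModuleCat.{u} R)}
    (hS : S.ShortExact) [Module.Projective R S.X₂] [Module.Finite R S.X₁]
    [Module.Projective R S.X₁]
    (h : Subsingleton (Ext.{u} S.X₃ (ModuleCat.of R R) 1)) : Module.Projective R S.X₃ := by
  have extend : ∀ f : S.X₁ →ₗ[R] R, ∃ g : S.X₂ →ₗ[R] R, ∀ x, g (S.f x) = f x := by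
    intro f
    obtain ⟨x₂, hx₂⟩ := Ext.contravariant_sequence_exact₁ hS (ModuleCat.of R R)
      (Ext.mk₀ (ModuleCat.ofHom f)) (add_zero 1) (Subsingleton.elim _ _)
    obtain ⟨g, rfl⟩ := Ext.mk₀_bijective _ _ |>.2 x₂
    rw [Ext.mk₀_comp_mk₀] at hx₂
    have := (Ext.mk₀_bijective _ _).1 hx₂
    exact ⟨g.hom, fun x => congrArg (fun t => t.hom x) this⟩
  obtain ⟨n, f, g, -, -, hfg⟩ := Module.Finite.exists_comp_eq_id_of_projective R S.X₁
  choose e he using fun i : Fin n => extend (LinearMap.proj i ∘ₗ g)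
  let r : S.X₂ →ₗ[R] S.X₁ := f ∘ₗ LinearMap.pi e
  have hr : ∀ x, r (S.f x) = x := by
    intro x
    have : (LinearMap.pi e) (S.f x) = g x := by
      ext i
      exact he i x
    change f ((LinearMap.pi e) (S.f x)) = x
    rw [this]
    exact congrArg (fun t => t x) hfg
  let spl := ShortComplex.Splitting.ofExactOfRetraction S hS.exact (ModuleCat.ofHom r)
    (by ext x; exact hr x) hS.epi_g
  refine Module.Projective.of_split spl.s.hom S.g.hom ?_
  ext x
  exact congrArg (fun t => t.hom x) spl.s_g

theorem CategoryTheory.ShortComplex.ShortExact.subsingleton_ext_X₁ {C : Type*} [Category C]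
    [Abelian C] [HasExt.{u} C] {S : ShortComplex C} (hS : S.ShortExact) [Projective S.X₂] (Y : C)
    {m : ℕ} (h : Subsingleton (Ext.{u} S.X₃ Y (m + 2))) :
    Subsingleton (Ext.{u} S.X₁ Y (m + 1)) := by
  refine subsingleton_of_forall_eq 0 fun x => ?_
  obtain ⟨x₂, hx₂⟩ := Ext.contravariant_sequence_exact₁ hS Y x (n₁ := m + 2) (by omega)
    (Subsingleton.elim _ _)
  rw [← hx₂, Ext.eq_zero_of_projective x₂, Ext.comp_zero]

/-- Dimension shifting kills the positive Ext groups of all syzygies Z (i + 1) into R. Far out these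
are zero, and projectivity descends from there to Z 1. -/
theorem ModuleCat.finitePresentation_and_hasProjectiveDimensionLT_two
    (Z : ℕ → ModuleCat.{u} R)
    (hZ : ∀ i, ∃ (X : ModuleCat.{u} R) (f : Z (i + 1) ⟶ X) (g : X ⟶ Z i) (w : f ≫ g = 0),
      Module.Finite R X ∧ Module.Projective R X ∧ (ShortComplex.mk f g w).ShortExact)
    {n : ℕ} (hn : ∀ i, n ≤ i → Subsingleton (Z i))
    (hext : ∀ m, Subsingleton (Ext.{u} (Z 0) (ModuleCat.of R R) (m + 2))) :
    Module.FinitePresentation R (Z 0) ∧ HasProjectiveDimensionLT (Z 0) 2 := by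
  have ext_succ : ∀ i m, Subsingleton (Ext.{u} (Z (i + 1)) (ModuleCat.of R R) (m + 1)) := by
    intro i
    induction i with
    | zero =>
      intro m
      obtain ⟨X, f, g, w, -, hX, hS⟩ := hZ 0
      exact hS.subsingleton_ext_X₁ (S := ShortComplex.mk f g w) _ (hext m)
    | succ i ih =>
      intro m
      obtain ⟨X, f, g, w, -, hX, hS⟩ := hZ (i + 1)
      exact hS.subsingleton_ext_X₁ (S := ShortComplex.mk f g w) _ (ih (m + 1))
  have finite : ∀ i, Module.Finite R (Z i) := by
    intro i
    obtain ⟨X, f, g, w, hfin, -, hS⟩ := hZ i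
    exact Module.Finite.of_surjective g.hom hS.moduleCat_surjective_g
  have projective : ∀ j i, n ≤ i + j → Module.Projective R (Z (i + 1)) := by
    intro j
    induction j with
    | zero =>
      intro i hi
      have := hn (i + 1) (by omega)
      have := Module.Free.of_subsingleton R (Z (i + 1))
      exact Module.Projective.of_free
    | succ j ih =>
      intro i hi
      obtain ⟨X, f, g, w, -, hX, hS⟩ := hZ (i + 1)
      have h1 := ih (i + 1) (by omega)
      have h2 := finite (i + 2)
      exact ModuleCat.projective_X₃_of_subsingleton_ext (S := ShortComplex.mk f g w) hS
        (ext_succ i 0)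
  obtain ⟨X, f, g, w, hfin, hX, hS⟩ := hZ 0
  have hZ1 : Module.Projective R (Z 1) := projective n 0 (by omega)
  have hZ1fin := finite 1
  constructor
  · have := Module.finitePresentation_of_projective R X
    refine Module.finitePresentation_of_surjective g.hom hS.moduleCat_surjective_g ?_
    rw [← hS.exact.moduleCat_range_eq_ker]
    exact Module.Finite.iff_fg.1 (Module.Finite.range f.hom)
  · have h3 : HasProjectiveDimensionLT (Z 1) 1 :=
      projective_iff_hasProjectiveDimensionLT_one.1 inferInstance
    have h4 : HasProjectiveDimensionLT X 1 :=
      projective_iff_hasProjectiveDimensionLT_one.1 inferInstance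
    exact hS.hasProjectiveDimensionLT_X₃ 1 h3 (hasProjectiveDimensionLT_of_ge X 1 2 (by omega))

/-- The module itself followed by the boundaries of a projective resolution. -/
noncomputable def CategoryTheory.ProjectiveResolution.syzygy {M : ModuleCat.{u} R}
    (P : ProjectiveResolution M) : ℕ → ModuleCat.{u} R
  | 0 => M
  | i + 1 => ModuleCat.of R (LinearMap.range (P.complex.d (i + 1) i).hom)

theorem CategoryTheory.ProjectiveResolution.exists_shortExact_syzygy {M : ModuleCat.{u} R}
    (P : ProjectiveResolution M) (i : ℕ) :
    ∃ (f : P.syzygy (i + 1) ⟶ P.complex.X i) (g : P.complex.X i ⟶ P.syzygy i) (w : f ≫ g = 0),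
      (ShortComplex.mk f g w).ShortExact := by
  obtain ⟨g, hg, hker⟩ : ∃ g : P.complex.X i ⟶ P.syzygy i, Function.Surjective g ∧
      LinearMap.range (P.complex.d (i + 1) i).hom = LinearMap.ker g.hom := by
    cases i with
    | zero =>
      have : Epi (P.π.f 0) := inferInstance
      exact ⟨P.π.f 0, (ModuleCat.epi_iff_surjective _).1 this,
        P.exact₀.moduleCat_range_eq_ker⟩
    | succ i =>
      refine ⟨ModuleCat.ofHom (P.complex.d (i + 1) i).hom.rangeRestrict,
        (P.complex.d (i + 1) i).hom.surjective_rangeRestrict, ?_⟩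
      exact (P.exact_succ i).moduleCat_range_eq_ker.trans (LinearMap.ker_rangeRestrict _).symm
  have w : ModuleCat.ofHom (LinearMap.range (P.complex.d (i + 1) i).hom).subtype ≫ g = 0 := by
    ext ⟨x, hx⟩
    rw [hker] at hx
    exact hx
  refine ⟨ModuleCat.ofHom (Submodule.subtype _), g, w, ?_⟩
  refine ShortComplex.ShortExact.mk' ?_ ?_ ?_
  · rw [ShortComplex.moduleCat_exact_iff_range_eq_ker]
    change LinearMap.range (Submodule.subtype _) = _
    rw [Submodule.range_subtype]
    exact hker
  · exact (ModuleCat.mono_iff_injective _).2 Subtype.val_injective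
  · exact (ModuleCat.epi_iff_surjective _).2 hg

theorem IsPerfectModule.finitePresentation_and_hasProjectiveDimensionLT_two
    {M : ModuleCat.{u} R} (hM : IsPerfectModule M)
    (hext : ∀ m, Subsingleton (Ext.{u} M (ModuleCat.of R R) (m + 2))) :
    Module.FinitePresentation R M ∧ HasProjectiveDimensionLT M 2 := by
  obtain ⟨P, hfin, n, hn⟩ := hM
  refine ModuleCat.finitePresentation_and_hasProjectiveDimensionLT_two P.syzygy (n := n + 2)
    (fun i => ?_) (fun i hi => ?_) hext
  · obtain ⟨f, g, w, hS⟩ := P.exists_shortExact_syzygy i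
    exact ⟨P.complex.X i, f, g, w, hfin i, (IsProjective.iff_projective _).2 (P.projective i), hS⟩
  · obtain ⟨f, g, w, hS⟩ := P.exists_shortExact_syzygy i
    have := ModuleCat.subsingleton_of_isZero (hn i (by omega))
    exact hS.moduleCat_surjective_g.subsingleton

end ProjectiveDimension

/-! ### Ext^1 of a cyclic module through the kernel of its presentation. -/

section CyclicModule

variable {R : Type u} [Ring R] {M : ModuleCat.{u} R} (l : R →ₗ[R] M)

/-- The complex `ker l → R → M` of a linear map `l : R → M`. -/
noncomputable abbrev kernelComplex : ShortComplex (ModuleCat.{u} R) :=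
  ShortComplex.mk (X₁ := ModuleCat.of R (LinearMap.ker l)) (X₂ := ModuleCat.of R R)
    (ModuleCat.ofHom (LinearMap.ker l).subtype) (ModuleCat.ofHom l) (by ext x; exact x.2)

variable {l}

theorem kernelComplex_shortExact (hl : Function.Surjective l) : (kernelComplex l).ShortExact := by
  refine ShortComplex.ShortExact.mk' ?_ ?_ ?_
  · rw [ShortComplex.moduleCat_exact_iff_range_eq_ker]
    exact Submodule.range_subtype _
  · exact (ModuleCat.mono_iff_injective _).2 Subtype.val_injective
  · exact (ModuleCat.epi_iff_surjective _).2 hl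

/-- Projective dimension at most one makes the kernel projective, and finite presentation makes it
finitely generated. -/
theorem exists_dual_basis_ker (hl : Function.Surjective l) [Module.FinitePresentation R M]
    (hM : HasProjectiveDimensionLT M 2) :
    ∃ (n : ℕ) (form : Fin n → LinearMap.ker l) (dual : Fin n → (LinearMap.ker l →ₗ[R] R)),
      ∀ x, x = ∑ i, dual i x • form i := by
  have hS := kernelComplex_shortExact hl
  have hR : Module.Projective R (ModuleCat.of R R) :=
    inferInstanceAs (Module.Projective R R)
  have h2 : HasProjectiveDimensionLT (ModuleCat.of R R) 1 :=
    projective_iff_hasProjectiveDimensionLT_one.1 inferInstance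
  have h3 : HasProjectiveDimensionLT (kernelComplex l).X₁ 1 :=
    hS.hasProjectiveDimensionLT_X₁ 1 h2 hM
  have h4 : Module.Projective R (LinearMap.ker l) :=
    (IsProjective.iff_projective _).2 (projective_iff_hasProjectiveDimensionLT_one.2 h3)
  have h5 : Module.Finite R (LinearMap.ker l) :=
    .of_fg (Module.FinitePresentation.fg_ker l hl)
  obtain ⟨n, f, g, -, -, hfg⟩ :=
    Module.Finite.exists_comp_eq_id_of_projective R (LinearMap.ker l)
  refine ⟨n, fun i => f fun j => if i = j then 1 else 0, fun i => LinearMap.proj i ∘ₗ g, fun x => ?_⟩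
  have h6 : f (g x) = x := congrArg (fun t => t x) hfg
  exact h6.symm.trans (LinearMap.pi_apply_eq_sum_univ f (g x))

/-- The connecting map `Hom_R(ker l, R) → Ext¹_R(M, R)`. -/
noncomputable def kerConnecting (hl : Function.Surjective l) :
    (LinearMap.ker l →ₗ[R] R) →+ Ext.{u} M (ModuleCat.of R R) 1 where
  toFun h := (kernelComplex_shortExact hl).extClass.comp
    (Ext.mk₀ (X := (kernelComplex l).X₁) (Y := ModuleCat.of R R) (ModuleCat.ofHom h)) (add_zero 1)
  map_zero' := by
    have : (ModuleCat.ofHom (0 : LinearMap.ker l →ₗ[R] R) :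
      (kernelComplex l).X₁ ⟶ ModuleCat.of R R) = 0 := rfl
    rw [this, Ext.mk₀_zero, Ext.comp_zero]
  map_add' h h' := by
    have : (ModuleCat.ofHom (h + h') : (kernelComplex l).X₁ ⟶ ModuleCat.of R R) =
      ModuleCat.ofHom h + ModuleCat.ofHom h' := rfl
    rw [this, Ext.mk₀_add, Ext.comp_add]

theorem kerConnecting_apply (hl : Function.Surjective l)
    (h : LinearMap.ker l →ₗ[R] R) :
    kerConnecting hl h = (kernelComplex_shortExact hl).extClass.comp
      (Ext.mk₀ (X := (kernelComplex l).X₁) (Y := ModuleCat.of R R) (ModuleCat.ofHom h))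
      (add_zero 1) :=
  rfl

theorem kerConnecting_surjective (hl : Function.Surjective l) : Function.Surjective (kerConnecting hl) := by
  intro e
  have hR : Projective (kernelComplex l).X₂ :=
    (IsProjective.iff_projective (R := R) R).1 inferInstance
  obtain ⟨x, hx⟩ := Ext.contravariant_sequence_exact₃ (kernelComplex_shortExact hl) _ e
    (Ext.eq_zero_of_projective _) (add_zero 1)
  obtain ⟨h, rfl⟩ := (Ext.mk₀_bijective _ _).2 x
  exact ⟨h.hom, hx⟩

/-- A map with zero class extends to R, and an endomorphism of the left module R is right
multiplication by the image of 1. -/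
theorem kerConnecting_eq_zero (hl : Function.Surjective l) {h : LinearMap.ker l →ₗ[R] R}
    (hh : kerConnecting hl h = 0) :
    ∃ r : R, ∀ x, h x = x * r := by
  obtain ⟨x, hx⟩ := Ext.contravariant_sequence_exact₁ (kernelComplex_shortExact hl) _ _
    (add_zero 1) hh
  obtain ⟨g, rfl⟩ := (Ext.mk₀_bijective _ _).2 x
  rw [Ext.mk₀_comp_mk₀] at hx
  have := (Ext.mk₀_bijective _ _).1 hx
  refine ⟨g.hom (1 : R), fun x => ?_⟩
  have h1 : g.hom (x : R) = h x := congrArg (fun t => t.hom x) this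
  have h2 : g.hom ((x : R) • (1 : R)) = (x : R) • g.hom (1 : R) := g.hom.map_smul _ _
  rw [← h1, ← smul_eq_mul (x : R) (g.hom (1 : R)), ← h2, smul_eq_mul, mul_one]

theorem extRightMul_kerConnecting (hl : Function.Surjective l) (h : LinearMap.ker l →ₗ[R] R)
    (r : R) :
    extRightMul (kerConnecting hl h) r =
      kerConnecting hl (LinearMap.toSpanSingleton R R r ∘ₗ h) := by
  rw [extRightMul, kerConnecting_apply, Ext.comp_assoc_of_third_deg_zero, Ext.mk₀_comp_mk₀]
  rfl

end CyclicModule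

/-! ### Duality data of a twisted Calabi-Yau algebra of dimension one. -/

section CalabiYau

variable {k : Type v} [Field k] {A : Type u} [Ring A] [Algebra k A]

theorem mulOpMap_mul (w z : A ⊗[k] Aᵐᵒᵖ) :
    mulOpMap k A (w * z) =
      (letI := instModuleTensorProductMop k A; w • mulOpMap k A z) := by
  let := instModuleTensorProductMop k A
  induction w with
  | zero => exact (congrArg _ (zero_mul z)).trans ((map_zero _).trans (zero_smul (A ⊗[k] Aᵐᵒᵖ) (mulOpMap k A z)).symm)
  | add x y hx hy => rw [add_mul, map_add, hx, hy, add_smul]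
  | tmul a b =>
    induction z with
    | zero => simp
    | add x y hx hy => rw [mul_add, map_add, hx, hy, map_add, smul_add]
    | tmul c d =>
      rw [Algebra.TensorProduct.tmul_mul_tmul, mulOpMap_tmul, mulOpMap_tmul]
      change _ = a • b • (c * d.unop)
      simp [mul_assoc, MulOpposite.smul_eq_mul_unop]

/-- The multiplication map as a map of left modules over the enveloping algebra. -/
noncomputable def mulOpHom (k : Type v) [Field k] (A : Type u) [Ring A] [Algebra k A] :
    EnvelopingAlgebra k A →ₗ[EnvelopingAlgebra k A] envelopingRegular k A :=
  { toFun := fun w => mulOpMap k A w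
    map_add' := fun x y => map_add (mulOpMap k A) x y
    map_smul' := fun x y => mulOpMap_mul x y }

theorem mulOpHom_surjective : Function.Surjective (mulOpHom k A) := fun a =>
  ⟨(show A from a) ⊗ₜ 1, (mulOpMap_tmul k A a 1).trans (mul_one _)⟩

theorem univDer_mem_ker_mulOpHom (a : A) : univDer k A a ∈ LinearMap.ker (mulOpHom k A) := by
  change mulOpMap k A (univDer k A a) = (0 : A)
  simp

/-- Composition of a linear map on the noncommutative differentials with the universal
derivation. -/
noncomputable def compUnivDer : (LinearMap.ker (mulOpHom k A) →ₗ[EnvelopingAlgebra k A]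
    EnvelopingAlgebra k A) →+ (A →ₗ[k] A ⊗[k] Aᵐᵒᵖ) where
  toFun h :=
    { toFun := fun c => h ⟨univDer k A c, univDer_mem_ker_mulOpHom c⟩
      map_add' := fun x y => by
        rw [← map_add]
        congr 1
        exact Subtype.ext (map_add (univDer k A) x y)
      map_smul' := fun t x => by
        have : (⟨univDer k A (t • x), univDer_mem_ker_mulOpHom _⟩ :
            LinearMap.ker (mulOpHom k A)) = algebraMap k (EnvelopingAlgebra k A) t •
              ⟨univDer k A x, univDer_mem_ker_mulOpHom x⟩ :=
          Subtype.ext (((univDer k A).map_smul t x).trans (Algebra.smul_def t (univDer k A x)))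
        rw [this, map_smul]
        exact (Algebra.smul_def t _).symm }
  map_zero' := rfl
  map_add' _ _ := rfl

theorem IsTwistedCalabiYau.nonempty_differentialDuality (h : IsTwistedCalabiYau k A 1) :
    Nonempty (DifferentialDuality k A) := by
  obtain ⟨hsmooth, hext, U, ⟨V, hUV, hVU⟩, φ, hφ⟩ := h
  obtain ⟨hfp, hpd⟩ := IsPerfectModule.finitePresentation_and_hasProjectiveDimensionLT_two hsmooth
    fun m => hext (m + 2) (by omega)
  obtain ⟨n, form, dual, hdual⟩ := exists_dual_basis_ker (l := mulOpHom k A) mulOpHom_surjective hpd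
  exact ⟨{
    U := U
    V := V
    left := hUV
    right := hVU
    H := LinearMap.ker (mulOpHom k A) →ₗ[EnvelopingAlgebra k A] EnvelopingAlgebra k A
    toDer := compUnivDer
    toU := φ.toAddMonoidHom.comp (kerConnecting mulOpHom_surjective)
    toU_surjective := φ.surjective.comp (kerConnecting_surjective mulOpHom_surjective)
    exists_mul_right := fun h a b => ⟨LinearMap.toSpanSingleton _ _ (a ⊗ₜ op b) ∘ₗ h,
      fun c => rfl, by
        -- The right A^e-action on Ext^1 is induced by composing h with right multiplication, so the
        -- bimodule compatibility of φ applies.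
        change φ (kerConnecting mulOpHom_surjective _) = b • (op a • φ _)
        rw [← extRightMul_kerConnecting]
        exact hφ _ a b⟩
    inner := fun h hh => by
      obtain ⟨r, hr⟩ := kerConnecting_eq_zero mulOpHom_surjective
        (φ.injective (hh.trans φ.map_zero.symm))
      exact ⟨r, fun c => hr _⟩
    n := n
    form := fun i => form i
    dual := dual
    mulOpMap_form := fun i => (form i).2
    dual_basis := fun a => by
      have := congrArg Subtype.val (hdual ⟨univDer k A a, univDer_mem_ker_mulOpHom a⟩)
      rw [AddSubmonoidClass.coe_finsetSum] at this
      exact this }⟩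

end CalabiYau

theorem mainTheorem6 {k : Type v} [Field k] {A : Type u} [Ring A] [Algebra k A]
    (𝒜 : ℕ → Submodule k A) [GradedAlgebra 𝒜]
    (locallyFinite : ∀ n, Module.Finite k (𝒜 n))
    (twistedCY : IsTwistedCalabiYau k A 1) :
    IsNoetherianRing A ∧ IsNoetherianRing Aᵐᵒᵖ := by
  obtain ⟨D⟩ := twistedCY.nonempty_differentialDuality
  exact ⟨D.isNoetherianRing 𝒜 locallyFinite, D.opposite.isNoetherianRing (oppositeGrading 𝒜)
    (finite_oppositeGrading 𝒜 locallyFinite)⟩
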